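/- A CNF formula is a conjunction of clauses, each clause being a disjunction of literals (variables or negated variables). A $(2,2)$-CNF formula is a CNF formula in which every clause has at most two literals and every variable appears in at most two clauses. Two assignments differ on a variable if they give it different truth values. Theorem. The problem Max Differ 2-SAT is polynomial-time solvable on $(2,2)$-CNF formulas. That is, there is a Turing machine which, given a $(2,2)$-CNF formula $\phi$ and a non-negative integer $d$ (with the names of the variables and the number $d$ written in binary), decides in time polynomial in the length of the input whether there are two satisfying assignments of $\phi$ that differ on at least $d$ of the variables of $\phi$. -/

import Mathlib

namespace MaxDiffer

/-! ### CNF formulas -/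

/-- A literal: a variable (named by a natural number) with a sign; `(x, true)` is the positive
literal `x`, `(x, false)` is the negative literal `¬x`. -/
abbrev Literal := ℕ × Bool

/-- A clause: a disjunction of literals. -/
abbrev Clause := List Literal

/-- A CNF formula: a conjunction of clauses. -/
abbrev CNF := List Clause

/-- The variables that appear in a clause. -/
def Clause.vars (C : Clause) : Finset ℕ := (C.map Prod.fst).toFinset

/-- The variables that appear in a formula; their number is the `n` of the formula. -/
def CNF.vars (φ : CNF) : Finset ℕ := (φ.flatMap fun C => C.map Prod.fst).toFinset

/-- An assignment of truth values; only its values on the variables of the formula under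
consideration are ever used. -/
abbrev Assignment := ℕ → Bool

/-- The assignment `σ` satisfies `φ`: every clause contains a literal that is true under `σ`. -/
def Satisfies (σ : Assignment) (φ : CNF) : Prop :=
  ∀ C ∈ φ, ∃ l ∈ C, σ l.1 = l.2

/-- The variables of `φ` on which `σ₁` and `σ₂` differ. -/
def differSet (φ : CNF) (σ₁ σ₂ : Assignment) : Finset ℕ :=
  φ.vars.filter fun x => σ₁ x ≠ σ₂ x

/-- A 2-CNF formula: at most two literals per clause. -/
def IsTwoCNF (φ : CNF) : Prop := ∀ C ∈ φ, C.length ≤ 2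

/-- A (2,2)-CNF formula: a 2-CNF formula in which each variable appears in at most two
clauses. -/
def IsTwoTwoCNF (φ : CNF) : Prop :=
  IsTwoCNF φ ∧ ∀ x : ℕ, φ.countP (fun C => decide (x ∈ Clause.vars C)) ≤ 2

/-! ### The decision problem -/

/-- An instance of the problem: a formula and a non-negative integer `d`. -/
abbrev Instance := CNF × ℕ

/-- YES-instances: there are two satisfying assignments of `φ` that differ on at least `d`
of its variables. -/
def IsYes (I : Instance) : Prop :=
  ∃ σ₁ σ₂ : Assignment, Satisfies σ₁ I.1 ∧ Satisfies σ₂ I.1 ∧ I.2 ≤ (differSet I.1 σ₁ σ₂).card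

/-- Instances whose formula is a (2,2)-CNF formula. -/
abbrev TwoTwoInstance := {I : Instance // IsTwoTwoCNF I.1}

/-! ### Binary encoding of instances -/

/-- The input alphabet. -/
inductive Sym
  | bit (b : Bool)
  | sign (b : Bool)
  | clause
  deriving DecidableEq, Fintype

/-- A natural number, written in binary. -/
def encodeNum (m : ℕ) : List Sym := (Computability.encodeNat m).map Sym.bit

/-- A literal: its sign followed by the name of its variable in binary. -/
def encodeLiteral (l : Literal) : List Sym := Sym.sign l.2 :: encodeNum l.1

/-- A clause: the symbol `clause` followed by its literals. -/
def encodeClause (C : Clause) : List Sym := Sym.clause :: C.flatMap encodeLiteral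

/-- A formula: its clauses, one after the other. -/
def encodeCNF (φ : CNF) : List Sym := φ.flatMap encodeClause

/-- An instance `(φ, d)`: the number `d` in binary followed by the formula. -/
def encodeInstance (I : Instance) : List Sym := encodeNum I.2 ++ encodeCNF I.1

/-! The encoding is uniquely decodable. -/

theorem encodeNum_append_inj {a b : ℕ} {s t : List Sym}
    (hs : ∀ c, s.head? ≠ some (Sym.bit c)) (ht : ∀ c, t.head? ≠ some (Sym.bit c))
    (h : encodeNum a ++ s = encodeNum b ++ t) : a = b ∧ s = t := by
  have key : ∀ u v : List Bool, u.map Sym.bit ++ s = v.map Sym.bit ++ t → u = v ∧ s = t := by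
    intro u
    induction u with
    | nil =>
      intro v h
      cases v with
      | nil => exact ⟨rfl, by simpa using h⟩
      | cons c v => exact absurd (by simp [show s = _ from h]) (hs c)
    | cons c u ih =>
      intro v h
      cases v with
      | nil => exact absurd (by simp [show t = _ from h.symm]) (ht c)
      | cons c' v =>
        simp only [List.map_cons, List.cons_append, List.cons.injEq, Sym.bit.injEq] at h
        obtain ⟨h1, h2⟩ := ih v h.2
        exact ⟨by rw [h.1, h1], h2⟩
  obtain ⟨h1, h2⟩ := key _ _ h
  exact ⟨by simpa using congrArg Computability.decodeNat h1, h2⟩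

theorem encodeCNF_head (φ : CNF) : (encodeCNF φ).head? = none ∨
    (encodeCNF φ).head? = some Sym.clause := by
  cases φ <;> simp [encodeCNF, encodeClause]

theorem encodeLits_append_inj {C D : Clause} {s t : List Sym}
    (hs : s.head? = none ∨ s.head? = some Sym.clause)
    (ht : t.head? = none ∨ t.head? = some Sym.clause)
    (h : C.flatMap encodeLiteral ++ s = D.flatMap encodeLiteral ++ t) : C = D ∧ s = t := by
  induction C generalizing D with
  | nil =>
    cases D with
    | nil => exact ⟨rfl, by simpa using h⟩
    | cons l D =>
      have h' : s = _ := h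
      rw [h'] at hs
      simp [encodeLiteral] at hs
  | cons l C ih =>
    cases D with
    | nil =>
      have h' : t = _ := h.symm
      rw [h'] at ht
      simp [encodeLiteral] at ht
    | cons l' D =>
      simp only [List.flatMap_cons, encodeLiteral, List.cons_append, List.append_assoc,
        List.cons.injEq, Sym.sign.injEq] at h
      have aux : ∀ (E : Clause) (r : List Sym), (r.head? = none ∨ r.head? = some Sym.clause) →
          ∀ c, (E.flatMap encodeLiteral ++ r).head? ≠ some (Sym.bit c) := by
        intro E r hr c
        cases E with
        | nil => rcases hr with hr | hr <;> simp [hr]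
        | cons e E => simp [encodeLiteral]
      obtain ⟨h1, h2⟩ := encodeNum_append_inj (aux C s hs) (aux D t ht) h.2
      obtain ⟨h3, h4⟩ := ih h2
      exact ⟨by rw [h3, Prod.ext h1 h.1], h4⟩

theorem encodeCNF_injective : Function.Injective encodeCNF := by
  intro φ
  induction φ with
  | nil => intro ψ h; cases ψ <;> simp_all [encodeCNF, encodeClause]
  | cons C φ ih =>
    intro ψ h
    cases ψ with
    | nil => simp [encodeCNF, encodeClause] at h
    | cons D ψ =>
      have h' : C.flatMap encodeLiteral ++ encodeCNF φ = D.flatMap encodeLiteral ++ encodeCNF ψ := by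
        simpa [encodeCNF, encodeClause] using h
      obtain ⟨h1, h2⟩ := encodeLits_append_inj (encodeCNF_head φ) (encodeCNF_head ψ) h'
      rw [h1, ih h2]

theorem encodeInstance_injective : Function.Injective encodeInstance := by
  have aux : ∀ (φ : CNF) (c : Bool), (encodeCNF φ).head? ≠ some (Sym.bit c) := by
    intro φ c
    rcases encodeCNF_head φ with h | h <;> simp [h]
  rintro ⟨φ, d⟩ ⟨ψ, e⟩ h
  obtain ⟨h1, h2⟩ := encodeNum_append_inj (aux φ) (aux ψ) h
  exact Prod.ext (encodeCNF_injective h2) h1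

/-! ### Polynomial-time solvability -/

/-- The decision problem `P` on instances of type `α`, written as strings by `enc`, is solvable
in polynomial time: some Turing machine (with finitely many stacks, labels and internal states,
and finite alphabets) halts on every instance `a` within a number of steps that is polynomial in
the length of `enc a`, and outputs the bit `true` if `P a` holds and `false` otherwise. -/
def PolyTimeSolvable {α Γ : Type} (enc : α → List Γ) (P : α → Prop) : Prop :=
  ∃ f : α → Bool, (∀ a, f a = true ↔ P a) ∧
    ∃ M : Turing.TM2ComputableInPolyTime enc Computability.encodeBool f,
      ∀ k, Finite (M.tm.Γ k)

end MaxDiffer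

/-! Maximising the number of variables on which two satisfying assignments differ means minimising
the size of a finite set `E` outside of which they are complementary (`Feasible`). With `n`
variables and least size `e`, the answer is yes exactly when such a pair exists and `d ≤ n - e`.

A clause equivalent to a single literal fixes its variable in both assignments. That variable is
lost, and it can be replaced by a constant in the other clauses (`feasible_cons_unit`). Clauses that
always hold are dropped, and a clause that is always false is a contradiction. Afterwards every
clause has two different variables and every variable has at most two occurrences.

If neither variable of such a clause is in `E`, both literals change value between the two
assignments, so exactly one of them is true in each: the clause is not-all-equal. Hence every clause
meets `E` or is not-all-equal (`Feasible.exists_covered`). Conversely such a cover gives two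
assignments as soon as every variable of `E` occurs with one sign only, because it can take that
sign in both (`feasible_of_covered`).

With variables as vertices and clauses as edges, the graph consists of paths and cycles, and the
not-all-equal conditions are linear equations over the field with two elements. They are solvable on
paths. A cycle may fail by parity, and then one variable is lost. If every vertex of a cycle
occurred with both signs, the parities would cancel, so an inconsistent cycle has a vertex with one
sign only. The formal argument contracts clauses: `x^s ∨ y^t` makes `x` a signed copy of `y`, and an
inconsistent cycle shrinks to a clause with the same literal twice. Covers pass down by
`covered_contract`. They lift back, keeping exempt variables of one sign, by `covered_uncontract`.
`solve_of_occ_le_two` and `feasible_iff_solve` conclude that `solve` computes `e`.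

For the running time, the procedure is written in a small stack language whose semantics counts
steps. `Run.steps` compiles its programs to stack machines without overhead, up to the final output
step. Substitution only copies names already present or the constant, so with `k` clauses and names
of length at most `w` each round is linear in `k * w`, up to lower order terms, and there are `k`
rounds. -/

namespace MaxDiffer

open Turing StateTransition

/-! ### A small imperative language on named stacks -/

/-- The stacks of the language. -/
inductive Reg
  | F | G | U | C | X | Y | T | S | W | B | N | D | R
  deriving DecidableEq

instance : Fintype Reg where
  elems := {.F, .G, .U, .C, .X, .Y, .T, .S, .W, .B, .N, .D, .R}
  complete k := by cases k <;> decide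

/-- The contents of all stacks. -/
@[ext] structure Mem where
  F : List Sym := []
  G : List Sym := []
  U : List Sym := []
  C : List Sym := []
  X : List Sym := []
  Y : List Sym := []
  T : List Sym := []
  S : List Sym := []
  W : List Sym := []
  B : List Sym := []
  N : List Sym := []
  D : List Sym := []
  R : List Sym := []

/-- The contents of one stack. -/
def Mem.get (m : Mem) : Reg → List Sym
  | .F => m.F
  | .G => m.G
  | .U => m.U
  | .C => m.C
  | .X => m.X
  | .Y => m.Y
  | .T => m.T
  | .S => m.S
  | .W => m.W
  | .B => m.B
  | .N => m.N
  | .D => m.D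
  | .R => m.R

/-- Replace the contents of one stack. -/
def Mem.set (m : Mem) : Reg → List Sym → Mem
  | .F, s => { m with F := s }
  | .G, s => { m with G := s }
  | .U, s => { m with U := s }
  | .C, s => { m with C := s }
  | .X, s => { m with X := s }
  | .Y, s => { m with Y := s }
  | .T, s => { m with T := s }
  | .S, s => { m with S := s }
  | .W, s => { m with W := s }
  | .B, s => { m with B := s }
  | .N, s => { m with N := s }
  | .D, s => { m with D := s }
  | .R, s => { m with R := s }

theorem Mem.get_set (m : Mem) (k j : Reg) (s : List Sym) :
    (m.set k s).get j = if j = k then s else m.get j := by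
  cases k <;> cases j <;> rfl

@[simp] theorem Mem.get_set_self (m : Mem) (k : Reg) (s : List Sym) : (m.set k s).get k = s := by
  simp [Mem.get_set]

theorem Mem.get_set_of_ne (m : Mem) {k j : Reg} (h : j ≠ k) (s : List Sym) :
    (m.set k s).get j = m.get j := by
  simp [Mem.get_set, h]

theorem Mem.ext_get {m m' : Mem} (h : ∀ k, m.get k = m'.get k) : m = m' := by
  ext1
  exacts [h .F, h .G, h .U, h .C, h .X, h .Y, h .T, h .S, h .W, h .B, h .N, h .D, h .R]

@[simp] theorem Mem.set_get (m : Mem) (k : Reg) : m.set k (m.get k) = m := by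
  cases k <;> rfl

@[simp] theorem Mem.set_set (m : Mem) (k : Reg) (s t : List Sym) :
    (m.set k s).set k t = m.set k t := by
  cases k <;> rfl

theorem Mem.set_comm (m : Mem) {k j : Reg} (h : k ≠ j) (s t : List Sym) :
    (m.set k s).set j t = (m.set j t).set k s := by
  apply Mem.ext_get
  intro i
  simp only [Mem.get_set]
  split_ifs with h1 h2 <;> simp_all

/-- Programs: straight-line stack operations, branching on the tops of two stacks, and loops
guarded by the tops of two stacks. -/
inductive Prog
  | nop
  | push (k : Reg) (a : Sym)
  | pop (k : Reg)
  | seq (p q : Prog)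
  | case (k j : Reg) (f : Option Sym → Option Sym → Prog)
  | loop (k j : Reg) (c : Option Sym → Option Sym → Bool) (p : Prog)

/-- Sequential composition. -/
infixr:60 " ;; " => Prog.seq

/-- `Run p m n m'`: started on `m`, the program `p` ends with `m'` after at most `n` steps. -/
inductive Run : Prog → Mem → ℕ → Mem → Prop
  | nop (m : Mem) : Run .nop m 1 m
  | push (k : Reg) (a : Sym) (m : Mem) : Run (.push k a) m 1 (m.set k (a :: m.get k))
  | pop (k : Reg) (m : Mem) : Run (.pop k) m 1 (m.set k (m.get k).tail)
  | seq {p q : Prog} {m m' m'' : Mem} {a b : ℕ} :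
      Run p m a m' → Run q m' b m'' → Run (p ;; q) m (a + b) m''
  | case {k j : Reg} {f : Option Sym → Option Sym → Prog} {m m' : Mem} {a : ℕ} :
      Run (f (m.get k).head? (m.get j).head?) m a m' → Run (.case k j f) m (a + 1) m'
  | loop_done {k j : Reg} {c : Option Sym → Option Sym → Bool} {p : Prog} {m : Mem} :
      c (m.get k).head? (m.get j).head? = false → Run (.loop k j c p) m 1 m
  | loop_step {k j : Reg} {c : Option Sym → Option Sym → Bool} {p : Prog} {m m' m'' : Mem}
      {a b : ℕ} : c (m.get k).head? (m.get j).head? = true → Run p m a m' →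
      Run (.loop k j c p) m' b m'' → Run (.loop k j c p) m (a + b + 1) m''
  | mono {p : Prog} {m m' : Mem} {a b : ℕ} : Run p m a m' → a ≤ b → Run p m b m'

/-! ### Compilation to stack machines -/

/-- The labels of the machine code of a program. -/
def Prog.Label : Prog → Type
  | .nop => Unit
  | .push _ _ => Unit
  | .pop _ => Unit
  | .seq p q => p.Label ⊕ q.Label
  | .case _ _ f => Option (Σ a : Option Sym × Option Sym, (f a.1 a.2).Label)
  | .loop _ _ _ p => Option p.Label

theorem Prog.finite_label : ∀ p : Prog, Finite p.Label
  | .nop => inferInstanceAs (Finite Unit)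
  | .push _ _ => inferInstanceAs (Finite Unit)
  | .pop _ => inferInstanceAs (Finite Unit)
  | .seq p q =>
    have := p.finite_label
    have := q.finite_label
    inferInstanceAs (Finite (p.Label ⊕ q.Label))
  | .case _ _ f =>
    have := fun a b => (f a b).finite_label
    inferInstanceAs (Finite (Option (Σ a : Option Sym × Option Sym, (f a.1 a.2).Label)))
  | .loop _ _ _ p =>
    have := p.finite_label
    inferInstanceAs (Finite (Option p.Label))

/-- The first label of the code of a program. -/
def Prog.entry : (p : Prog) → p.Label
  | .nop => ()
  | .push _ _ => ()
  | .pop _ => ()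
  | .seq p _ => Sum.inl p.entry
  | .case _ _ _ => none
  | .loop _ _ _ _ => none

/-- The alphabets of the machine: one output stack of bits besides the stacks of the language. -/
abbrev StackSym : Option Reg → Type
  | none => Bool
  | some _ => Sym

/-- The finite control: the two symbols read last. -/
abbrev Control := Option Sym × Option Sym

/-- The tops of two stacks are read into the control. -/
def peekTwo {Λ : Type} (k j : Reg) (q : TM2.Stmt StackSym Λ Control) :
    TM2.Stmt StackSym Λ Control :=
  .peek (some k) (fun v a => (a, v.2)) (.peek (some j) (fun v a => (v.1, a)) q)

/-- The machine code of a program, with its labels embedded by `emb`, continuing at `exit`. -/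
def Prog.code {Λ : Type} : (p : Prog) → (p.Label → Λ) → Λ → p.Label → TM2.Stmt StackSym Λ Control
  | .nop, _, exit, _ => .goto fun _ => exit
  | .push k a, _, exit, _ => .push (some k) (fun _ => a) (.goto fun _ => exit)
  | .pop k, _, exit, _ => .pop (some k) (fun v _ => v) (.goto fun _ => exit)
  | .seq p q, emb, exit, l =>
    match (l : p.Label ⊕ q.Label) with
    | Sum.inl l => p.code (fun l => emb (Sum.inl l)) (emb (Sum.inr q.entry)) l
    | Sum.inr l => q.code (fun l => emb (Sum.inr l)) exit l
  | .case k j f, emb, exit, l =>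
    match (l : Option (Σ a : Option Sym × Option Sym, (f a.1 a.2).Label)) with
    | none => peekTwo k j (.goto fun v => emb (some ⟨v, (f v.1 v.2).entry⟩))
    | some ⟨a, l⟩ => (f a.1 a.2).code (fun l => emb (some ⟨a, l⟩)) exit l
  | .loop k j c p, emb, exit, l =>
    match (l : Option p.Label) with
    | none => peekTwo k j (.goto fun v => if c v.1 v.2 then emb (some p.entry) else exit)
    | some l => p.code (fun l => emb (some l)) (emb none) l

/-- The stacks of the machine for given contents of the stacks of the language. -/
def Mem.stacks (m : Mem) : ∀ k, List (StackSym k)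
  | none => []
  | some k => m.get k

theorem Mem.update_stacks (m : Mem) (k : Reg) (s : List Sym) :
    Function.update m.stacks (some k) s = (m.set k s).stacks := by
  funext j
  cases j with
  | none => simp [Mem.stacks]
  | some j =>
    by_cases h : j = k
    · subst h
      simp [Mem.stacks]
    · rw [Function.update_of_ne (by simpa using h)]
      simp [Mem.stacks, Mem.get_set_of_ne _ h]

/-- `Steps M c n c'`: the machine `M` goes from `c` to `c'` in at most `n` steps. -/
def Steps {Λ : Type} (M : Λ → TM2.Stmt StackSym Λ Control)
    (c : TM2.Cfg StackSym Λ Control) (n : ℕ) (c' : TM2.Cfg StackSym Λ Control) : Prop :=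
  Nonempty (EvalsToInTime (TM2.step M) c (some c') n)

theorem Steps.trans {Λ : Type} {M : Λ → TM2.Stmt StackSym Λ Control}
    {c c' c'' : TM2.Cfg StackSym Λ Control} {a b : ℕ} (h : Steps M c a c') (h' : Steps M c' b c'') :
    Steps M c (a + b) c'' := by
  obtain ⟨h⟩ := h
  obtain ⟨h'⟩ := h'
  rw [add_comm]
  exact ⟨EvalsToInTime.trans _ _ _ _ _ _ h h'⟩

theorem Steps.mono {Λ : Type} {M : Λ → TM2.Stmt StackSym Λ Control}
    {c c' : TM2.Cfg StackSym Λ Control} {a b : ℕ} (h : Steps M c a c') (hab : a ≤ b) :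
    Steps M c b c' :=
  h.map fun h => ⟨h.toEvalsTo, h.steps_le_m.trans hab⟩

theorem Steps.single {Λ : Type} {M : Λ → TM2.Stmt StackSym Λ Control}
    {c c' : TM2.Cfg StackSym Λ Control} (h : TM2.step M c = some c') : Steps M c 1 c' :=
  ⟨⟨⟨1, h⟩, le_rfl⟩⟩

/-- The machine code of a program does what the program does. -/
theorem Run.steps {p : Prog} {m m' : Mem} {n : ℕ} (h : Run p m n m') :
    ∀ {Λ : Type} (M : Λ → TM2.Stmt StackSym Λ Control) (emb : p.Label → Λ) (exit : Λ),
      (∀ l, M (emb l) = p.code emb exit l) → ∀ v,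
      ∃ v', Steps M ⟨some (emb p.entry), v, m.stacks⟩ n ⟨some exit, v', m'.stacks⟩ := by
  -- The label type, the embedding, the exit and the initial control stay universally quantified:
  -- the code of a subprogram sits elsewhere in the same machine, with another exit, and starts with
  -- whatever control the preceding code has left.
  induction h with
  | nop m =>
    intro Λ M emb exit hM v
    exact ⟨v, Steps.single (by simp [hM, Prog.code])⟩
  | push k a m =>
    intro Λ M emb exit hM v
    refine ⟨v, Steps.single ?_⟩
    simp only [TM2.step, hM, Prog.code, TM2.stepAux]
    rw [← Mem.update_stacks]
    rfl
  | pop k m =>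
    intro Λ M emb exit hM v
    refine ⟨v, Steps.single ?_⟩
    simp only [TM2.step, hM, Prog.code, TM2.stepAux]
    rw [← Mem.update_stacks]
    rfl
  | seq _ _ ih1 ih2 =>
    intro Λ M emb exit hM v
    -- The exit of the first program is the entry of the second, so the two runs compose without an
    -- intermediate step.
    obtain ⟨v1, h1⟩ := ih1 M (fun l => emb (Sum.inl l)) _ (fun l => hM (Sum.inl l)) v
    obtain ⟨v2, h2⟩ := ih2 M (fun l => emb (Sum.inr l)) exit (fun l => hM (Sum.inr l)) v1
    exact ⟨v2, h1.trans h2⟩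
  | @case k j f m m' a _ ih =>
    intro Λ M emb exit hM v
    obtain ⟨v1, h1⟩ := ih M
      (fun l => emb (some ⟨((m.get k).head?, (m.get j).head?), l⟩)) exit
      (fun l => hM (some ⟨((m.get k).head?, (m.get j).head?), l⟩))
      ((m.get k).head?, (m.get j).head?)
    refine ⟨v1, ?_⟩
    rw [add_comm]
    refine Steps.trans (Steps.single ?_) h1
    simp only [TM2.step]
    rw [show M (emb (Prog.entry (.case k j f))) = _ from hM none]
    rfl
  | @loop_done k j c p m hc =>
    intro Λ M emb exit hM v
    refine ⟨((m.get k).head?, (m.get j).head?), Steps.single ?_⟩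
    simp only [TM2.step]
    rw [show M (emb (Prog.entry (.loop k j c p))) = _ from hM none]
    simp only [Prog.code, peekTwo, TM2.stepAux, Mem.stacks]
    erw [hc]
    rfl
  | @loop_step k j c p m m' m'' a b hc _ _ ih1 ih2 =>
    intro Λ M emb exit hM v
    obtain ⟨v1, h1⟩ := ih1 M (fun l => emb (some l)) (emb none) (fun l => hM (some l))
      ((m.get k).head?, (m.get j).head?)
    obtain ⟨v2, h2⟩ := ih2 M emb exit hM v1
    refine ⟨v2, ?_⟩
    rw [add_comm]
    refine Steps.trans (Steps.single ?_) (h1.trans h2)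
    simp only [TM2.step]
    rw [show M (emb (Prog.entry (.loop k j c p))) = _ from hM none]
    simp only [Prog.code, peekTwo, TM2.stepAux, Mem.stacks]
    erw [hc]
    rfl
  | mono _ hab ih =>
    intro Λ M emb exit hM v
    obtain ⟨v1, h1⟩ := ih M emb exit hM v
    exact ⟨v1, h1.mono hab⟩

/-- The code of the whole machine: after the program has ended, the bit on top of stack `R` is
moved to the output stack. -/
def Prog.fullCode (p : Prog) : Option p.Label → TM2.Stmt StackSym (Option p.Label) Control
  | none => .pop (some .R) (fun _ a => (a, none)) (.push none
      (fun v => decide (v.1 = some (Sym.bit true))) (.load (fun _ => (none, none)) .halt))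
  | some l => p.code some none l

/-- The machine of a program: the input is on stack `F`. -/
noncomputable def Prog.machine (p : Prog) : FinTM2 where
  K := Option Reg
  k₀ := some .F
  k₁ := none
  Γ := StackSym
  Λ := Option p.Label
  main := some p.entry
  ΛFin := @Fintype.ofFinite _ (have := p.finite_label; inferInstance)
  σ := Control
  initialState := (none, none)
  Γk₀Fin := inferInstanceAs (Fintype Sym)
  m := p.fullCode

/-- A halting configuration must have the control reset and every stack except the output empty.
Hence the run has to leave nothing but the answer on `R`, and one extra step carries it over. -/
theorem Prog.machine_outputs (p : Prog) {s : List Sym} {b : Bool} {n : ℕ}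
    (h : Run p { F := s } n { R := [Sym.bit b] }) :
    Nonempty (TM2OutputsInTime p.machine s (some [b]) (n + 1)) := by
  obtain ⟨v, h1⟩ := h.steps p.fullCode some none (fun _ => rfl) (none, none)
  have h2 : Steps p.fullCode ⟨some none, v, Mem.stacks { R := [Sym.bit b] }⟩ 1
      ⟨none, (none, none), Function.update (Mem.stacks {}) none [b]⟩ := by
    refine Steps.single ?_
    simp only [TM2.step, Prog.fullCode, TM2.stepAux]
    congr 2
    funext k
    rcases k with _ | k
    · cases b <;> rfl
    · cases k <;> rfl
  have h3 := h1.trans h2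
  have e1 : initList p.machine s =
      (⟨some (some p.entry), (none, none), Mem.stacks { F := s }⟩ :
        TM2.Cfg StackSym (Option p.Label) Control) := by
    unfold initList
    congr 1
    funext k
    rcases k with _ | k
    · rfl
    · cases k <;> rfl
  have e2 : haltList p.machine [b] =
      (⟨none, (none, none), Function.update (Mem.stacks {}) none [b]⟩ :
        TM2.Cfg StackSym (Option p.Label) Control) := by
    unfold haltList
    congr 1
    funext k
    rcases k with _ | k
    · rfl
    · cases k <;> rfl
  unfold TM2OutputsInTime
  rw [e1, Option.map_some, e2]
  exact h3

/-- A problem decided by a program of the language in polynomial time is solvable in polynomial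
time. -/
theorem polyTimeSolvable_of_run {α : Type} (enc : α → List Sym) (P : α → Prop) (p : Prog)
    (t : Polynomial ℕ)
    (h : ∀ a, ∃ b : Bool, (b = true ↔ P a) ∧
      Run p { F := enc a } (t.eval (enc a).length) { R := [Sym.bit b] }) :
    PolyTimeSolvable enc P := by
  choose f hf hrun using h
  refine ⟨f, hf, ⟨⟨p.machine, Equiv.refl _, Equiv.refl _⟩, t + 1, fun a => ?_⟩, ?_⟩
  · refine Classical.choice ?_
    rw [Polynomial.eval_add, Polynomial.eval_one]
    -- The input reaches the machine as the image of `enc a` under the identity equivalence of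
    -- alphabets, so the claim is stated for any word equal to `enc a`.
    have key : ∀ s, s = enc a → Nonempty (TM2OutputsInTime p.machine s (some [f a])
        (t.eval (enc a).length + 1)) := by
      rintro _ rfl
      exact p.machine_outputs (hrun a)
    exact key _ (List.map_id _)
  · rintro (_ | k)
    · exact inferInstanceAs (Finite Bool)
    · exact inferInstanceAs (Finite Sym)

end MaxDiffer

namespace MaxDiffer

/-! ### Formulas with two literals per clause -/

/-- A variable, or the constant `false`. -/
abbrev Var := Option ℕ

/-- A literal over a variable or a constant. -/
abbrev Lit := Var × Bool

/-- A clause with two literals. -/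
abbrev Pair := Lit × Lit

/-- Whether a literal is true. -/
def val (A : Var → Bool) (l : Lit) : Bool := A l.1 == l.2

/-- A clause that contains a constant or twice the same variable. -/
def special (c : Pair) : Bool :=
  decide (c.1.1 = c.2.1) || (decide (c.1.1 = none) || decide (c.2.1 = none))

/-- The special clauses are moved to the front. -/
def order (φ : List Pair) : List Pair := φ.filter special ++ φ.filter fun c => !special c

/-- Replace the variable `x` by `y`, with the opposite sign if `r` holds. -/
def substLit (x y : Var) (r : Bool) (l : Lit) : Lit := if l.1 = x then (y, xor l.2 r) else l

/-- Replace the variable `x` by `y` in a clause. -/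
def substPair (x y : Var) (r : Bool) (c : Pair) : Pair := (substLit x y r c.1, substLit x y r c.2)

/-- The effect of a clause on the others. -/
inductive Action
  | drop
  | reject
  | subst (x y : Var) (r : Bool) (loss : ℕ)

/-- A constant is put into the second place. -/
def normalize (c : Pair) : Pair := if c.1.1 = none then (c.2, c.1) else c

/-- The effect of the clause `x^s ∨ y^t`: a clause that amounts to one literal makes it true, at
the loss of one variable, and a clause of two variables makes its literals different. -/
def clauseAction (c : Pair) : Action :=
  if c.2.1 = none then
    if c.2.2 = false then .drop
    else if c.1.1 = none then (if c.1.2 then .reject else .drop)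
    else .subst c.1.1 none c.1.2 1
  else if c.1.1 = c.2.1 then (if c.1.2 = c.2.2 then .subst c.1.1 none c.1.2 1 else .drop)
  else .subst c.1.1 c.2.1 (c.1.2 == c.2.2) 0

/-- The number of variables lost and the number of contradictions met. -/
def solve : ℕ → List Pair → ℕ × ℕ
  | 0, _ => (0, 0)
  | k + 1, φ =>
    match order φ with
    | [] => (0, 0)
    | c :: ψ =>
      match clauseAction (normalize c) with
      | .drop => solve k ψ
      | .reject => ((solve k ψ).1, (solve k ψ).2 + 1)
      | .subst x y r j =>
        ((solve k (ψ.map (substPair x y r))).1 + j, (solve k (ψ.map (substPair x y r))).2)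

/-! ### Semantics of substitution and elimination of special clauses -/

theorem order_perm (φ : List Pair) : (order φ).Perm φ := List.filter_append_perm _ _

theorem order_length (φ : List Pair) : (order φ).length = φ.length := (order_perm φ).length_eq

/-- Special clauses come first, so a head that is not special shows that the first phase of the
algorithm is over. -/
theorem special_of_order {φ ψ : List Pair} {c : Pair} (h : order φ = c :: ψ)
    (hc : special c = false) : ∀ d ∈ c :: ψ, special d = false := by
  have h1 : φ.filter special = [] := by
    cases h2 : φ.filter special with
    | nil => rfl
    | cons d l =>
      have : d = c := by
        rw [order, h2] at h
        simpa using congrArg List.head? h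
      have h3 : d ∈ φ.filter special := by simp [h2]
      rw [List.mem_filter, this, hc] at h3
      simp at h3
  rw [order, h1, List.nil_append] at h
  intro d hd
  rw [← h, List.mem_filter] at hd
  simpa using hd.2

/-- The substitution lemma: replacing `x` in the syntax amounts to giving `x` the value of its
replacement in the assignment. -/
theorem val_substLit (A : Var → Bool) (x y : Var) (r : Bool) (l : Lit) :
    val A (substLit x y r l) = val (Function.update A x (xor (A y) r)) l := by
  unfold val substLit
  by_cases h : l.1 = x
  · simp only [h, if_true, Function.update_self]
    cases A y <;> cases r <;> cases l.2 <;> rfl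
  · simp [h]

/-- Whether a clause holds. -/
def PairHolds (A : Var → Bool) (c : Pair) : Prop := val A c.1 = true ∨ val A c.2 = true

theorem pairHolds_substPair (A : Var → Bool) (x y : Var) (r : Bool) (c : Pair) :
    PairHolds A (substPair x y r c) ↔ PairHolds (Function.update A x (xor (A y) r)) c := by
  simp [PairHolds, substPair, val_substLit]

/-- There are two satisfying assignments that agree on at most `j` variables. -/
def Feasible (φ : List Pair) (j : ℕ) : Prop :=
  ∃ (A₁ A₂ : Var → Bool) (E : Finset Var), E.card ≤ j ∧ A₁ none = false ∧ A₂ none = false ∧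
    (∀ c ∈ φ, PairHolds A₁ c) ∧ (∀ c ∈ φ, PairHolds A₂ c) ∧
    ∀ x, x ≠ none → x ∉ E → A₁ x ≠ A₂ x

theorem Feasible.perm {φ ψ : List Pair} (h : φ.Perm ψ) (j : ℕ) : Feasible φ j ↔ Feasible ψ j := by
  simp only [Feasible, h.mem_iff]

theorem feasible_cons_of_holds {c : Pair} {φ : List Pair}
    (hc : ∀ A : Var → Bool, A none = false → PairHolds A c) (j : ℕ) :
    Feasible (c :: φ) j ↔ Feasible φ j := by
  constructor
  · rintro ⟨A₁, A₂, E, hE, h1, h2, h3, h4, h5⟩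
    exact ⟨A₁, A₂, E, hE, h1, h2, fun c hc => h3 c (List.mem_cons_of_mem _ hc),
      fun c hc => h4 c (List.mem_cons_of_mem _ hc), h5⟩
  · rintro ⟨A₁, A₂, E, hE, h1, h2, h3, h4, h5⟩
    exact ⟨A₁, A₂, E, hE, h1, h2, by simpa using ⟨hc _ h1, by simpa using h3⟩,
      by simpa using ⟨hc _ h2, by simpa using h4⟩, h5⟩

theorem not_feasible_cons {c : Pair} {φ : List Pair}
    (hc : ∀ A : Var → Bool, A none = false → ¬ PairHolds A c) (j : ℕ) :
    ¬ Feasible (c :: φ) j := by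
  rintro ⟨A₁, A₂, E, hE, h1, h2, h3, h4, h5⟩
  exact hc _ h1 (h3 c (by simp))

/-- Both assignments must give `x` the value `s`, so `x` lies in `E` and costs one. After `x` has
become a constant it no longer constrains anything, so it can leave `E` again. -/
theorem feasible_cons_unit {c : Pair} {φ : List Pair} {x : Var} {s : Bool} (hx : x ≠ none)
    (hc : ∀ A : Var → Bool, A none = false → (PairHolds A c ↔ A x = s)) (j : ℕ) :
    Feasible (c :: φ) j ↔ 1 ≤ j ∧ Feasible (φ.map (substPair x none s)) (j - 1) := by
  constructor
  · rintro ⟨A₁, A₂, E, hE, h1, h2, h3, h4, h5⟩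
    have e1 := (hc _ h1).1 (h3 c (by simp))
    have e2 := (hc _ h2).1 (h4 c (by simp))
    have hxE : x ∈ E := by
      by_contra h
      exact h5 x hx h (e1.trans e2.symm)
    have hcard := Finset.card_erase_add_one hxE
    -- The substituted clauses do not mention `x`, so its two values are free and are chosen
    -- different to justify removing `x` from `E`.
    refine ⟨by omega, Function.update A₁ x true, Function.update A₂ x false, E.erase x, by omega,
      by rwa [Function.update_of_ne hx.symm], by rwa [Function.update_of_ne hx.symm], ?_, ?_, ?_⟩
    · simp only [List.forall_mem_map, pairHolds_substPair, Function.update_idem]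
      intro d hd
      rw [Function.update_of_ne hx.symm, h1, Bool.false_xor, ← e1, Function.update_eq_self]
      exact h3 d (List.mem_cons_of_mem _ hd)
    · simp only [List.forall_mem_map, pairHolds_substPair, Function.update_idem]
      intro d hd
      rw [Function.update_of_ne hx.symm, h2, Bool.false_xor, ← e2, Function.update_eq_self]
      exact h4 d (List.mem_cons_of_mem _ hd)
    · intro z hz hzE
      by_cases h : z = x
      · simp [h]
      · rw [Function.update_of_ne h, Function.update_of_ne h]
        exact h5 z hz (by simpa [h] using hzE)
  · rintro ⟨hj, A₁, A₂, E, hE, h1, h2, h3, h4, h5⟩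
    simp only [List.forall_mem_map, pairHolds_substPair, h1, h2, Bool.false_xor] at h3 h4
    have n1 : Function.update A₁ x s none = false := by rwa [Function.update_of_ne hx.symm]
    have n2 : Function.update A₂ x s none = false := by rwa [Function.update_of_ne hx.symm]
    refine ⟨Function.update A₁ x s, Function.update A₂ x s, insert x E, ?_, n1, n2, ?_, ?_, ?_⟩
    · have := Finset.card_insert_le x E
      omega
    · intro d hd
      rcases List.mem_cons.1 hd with rfl | hd
      · rw [hc _ n1, Function.update_self]
      · exact h3 d hd
    · intro d hd
      rcases List.mem_cons.1 hd with rfl | hd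
      · rw [hc _ n2, Function.update_self]
      · exact h4 d hd
    · intro z hz hzE
      simp only [Finset.mem_insert, not_or] at hzE
      rw [Function.update_of_ne hzE.1, Function.update_of_ne hzE.1]
      exact h5 z hz hzE.2

/-! ### Formulas without constants -/

/-- The number of occurrences of a variable. -/
def occ (z : Var) (φ : List Pair) : ℕ :=
  (φ.map fun c => (if c.1.1 = z then 1 else 0) + if c.2.1 = z then 1 else 0).sum

@[simp] theorem occ_nil (z : Var) : occ z [] = 0 := rfl

@[simp] theorem occ_cons (z : Var) (c : Pair) (φ : List Pair) :
    occ z (c :: φ) = ((if c.1.1 = z then 1 else 0) + if c.2.1 = z then 1 else 0) + occ z φ := by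
  simp [occ]

@[simp] theorem occ_append (z : Var) (φ ψ : List Pair) : occ z (φ ++ ψ) = occ z φ + occ z ψ := by
  simp [occ]

theorem occ_perm {φ ψ : List Pair} (h : φ.Perm ψ) (z : Var) : occ z φ = occ z ψ :=
  (h.map _).sum_eq

theorem not_mem_of_occ_eq_zero {z : Var} {φ : List Pair} (h : occ z φ = 0) {c : Pair}
    (hc : c ∈ φ) : c.1.1 ≠ z ∧ c.2.1 ≠ z := by
  obtain ⟨a, b, rfl⟩ := List.append_of_mem hc
  simp only [occ_append, occ_cons] at h
  constructor <;> intro h' <;> simp [h'] at h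

theorem eq_of_occ_le_one {z : Var} {φ : List Pair} (h : occ z φ ≤ 1) {c d : Pair} (hc : c ∈ φ)
    (hd : d ∈ φ) (hcz : c.1.1 = z ∨ c.2.1 = z) (hdz : d.1.1 = z ∨ d.2.1 = z) :
    c = d ∧ ¬ (c.1.1 = z ∧ c.2.1 = z) := by
  obtain ⟨a, b, rfl⟩ := List.append_of_mem hc
  simp only [occ_append, occ_cons] at h
  have h1 : 1 ≤ (if c.1.1 = z then 1 else 0) + if c.2.1 = z then 1 else 0 := by
    rcases hcz with h | h <;> simp [h]
  refine ⟨?_, ?_⟩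
  · by_contra hne
    have hd' : d ∈ a ∨ d ∈ b := by
      simp only [List.mem_append, List.mem_cons] at hd
      rcases hd with hd | hd | hd
      exacts [Or.inl hd, absurd hd.symm hne, Or.inr hd]
    rcases hd' with hd' | hd'
    · have := not_mem_of_occ_eq_zero (z := z) (φ := a) (by omega) hd'
      tauto
    · have := not_mem_of_occ_eq_zero (z := z) (φ := b) (by omega) hd'
      tauto
  · rintro ⟨h2, h3⟩
    simp only [h2, h3, if_true] at h
    omega

theorem substLit_of_ne {x y : Var} {r : Bool} {l : Lit} (h : l.1 ≠ x) : substLit x y r l = l :=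
  if_neg h

theorem map_substPair_of_occ_eq_zero {x y : Var} {r : Bool} {φ : List Pair} (h : occ x φ = 0) :
    φ.map (substPair x y r) = φ := by
  conv_rhs => rw [← List.map_id φ]
  refine List.map_congr_left fun c hc => ?_
  obtain ⟨h1, h2⟩ := not_mem_of_occ_eq_zero h hc
  simp [substPair, substLit_of_ne h1, substLit_of_ne h2]

theorem occ_substPair_self {x y : Var} (hxy : x ≠ y) (r : Bool) (φ : List Pair) :
    occ x (φ.map (substPair x y r)) = 0 := by
  induction φ with
  | nil => rfl
  | cons c φ ih =>
    rw [List.map_cons, occ_cons, ih]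
    unfold substPair substLit
    split_ifs <;> simp_all

/-- This preserves the bound of two under contraction: the contracted clause uses up one occurrence
of `x` and one of `y`, and at most one of each remains to be merged. -/
theorem occ_substPair_target {x y : Var} (hxy : x ≠ y) (r : Bool) (φ : List Pair) :
    occ y (φ.map (substPair x y r)) = occ y φ + occ x φ := by
  induction φ with
  | nil => rfl
  | cons c φ ih =>
    rw [List.map_cons, occ_cons, ih, occ_cons, occ_cons]
    simp only [substPair, substLit]
    by_cases h1 : c.1.1 = x <;> by_cases h2 : c.2.1 = x <;> simp [h1, h2, hxy] <;> omega

theorem occ_substPair_other {x y z : Var} (hzx : z ≠ x) (hzy : z ≠ y) (r : Bool) (φ : List Pair) :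
    occ z (φ.map (substPair x y r)) = occ z φ := by
  induction φ with
  | nil => rfl
  | cons c φ ih =>
    have key : ∀ l : Lit, ((substLit x y r l).1 = z) ↔ l.1 = z := by
      intro l
      unfold substLit
      split_ifs with h
      · simp [h, hzx.symm, hzy.symm]
      · rfl
    rw [List.map_cons, occ_cons, ih, occ_cons]
    simp only [substPair, key]

/-! ### Not-all-equal covers and contraction of clauses -/

/-- The literals of a clause have different truth values. -/
def NotAllEqual (A : Var → Bool) (c : Pair) : Prop := val A c.1 ≠ val A c.2

/-- Every clause either contains a variable of `E` or has literals with different values. -/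
def Covered (A : Var → Bool) (E : Finset Var) (c : Pair) : Prop :=
  c.1.1 ∈ E ∨ c.2.1 ∈ E ∨ NotAllEqual A c

/-- The variable `x` has only occurrences of one sign. -/
def PureIn (φ : List Pair) (x : Var) : Prop :=
  ∃ s, ∀ c ∈ φ, (c.1.1 = x → c.1.2 = s) ∧ (c.2.1 = x → c.2.2 = s)

theorem notAllEqual_substPair (A : Var → Bool) (x y : Var) (r : Bool) (c : Pair) :
    NotAllEqual A (substPair x y r c) ↔ NotAllEqual (Function.update A x (xor (A y) r)) c := by
  simp [NotAllEqual, substPair, val_substLit]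

/-- At most one clause contains `v`, and it contains `v` once. If that clause is not covered,
flipping `v` makes it not-all-equal and affects no other clause. -/
theorem exists_covered_of_occ_le_one {φ : List Pair} {v : Var} {A : Var → Bool} {E : Finset Var}
    (hocc : occ v φ ≤ 1) (h : ∀ c ∈ φ, c.1.1 ≠ v → c.2.1 ≠ v → Covered A E c) :
    ∃ A', ∀ c ∈ φ, Covered A' E c := by
  by_cases hall : ∀ c ∈ φ, Covered A E c
  · exact ⟨A, hall⟩
  push Not at hall
  obtain ⟨c, hc, hcov⟩ := hall
  have hcv : c.1.1 = v ∨ c.2.1 = v := by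
    by_contra hcon
    push Not at hcon
    exact hcov (h c hc hcon.1 hcon.2)
  refine ⟨Function.update A v (!A v), fun d hd => ?_⟩
  by_cases hdv : d.1.1 = v ∨ d.2.1 = v
  · obtain ⟨rfl, hne⟩ := eq_of_occ_le_one hocc hc hd hcv hdv
    unfold Covered NotAllEqual val at *
    push Not at hcov
    refine Or.inr (Or.inr ?_)
    have h3 := hcov.2.2
    rcases hcv with h1 | h1
    · have h2 : c.2.1 ≠ v := fun h2 => hne ⟨h1, h2⟩
      rw [h1, Function.update_self, Function.update_of_ne h2]
      rw [h1] at h3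
      revert h3
      cases A v <;> cases A c.2.1 <;> cases c.1.2 <;> cases c.2.2 <;> decide
    · have h2 : c.1.1 ≠ v := fun h2 => hne ⟨h2, h1⟩
      rw [h1, Function.update_self, Function.update_of_ne h2]
      rw [h1] at h3
      revert h3
      cases A v <;> cases A c.1.1 <;> cases c.1.2 <;> cases c.2.2 <;> decide
  · push Not at hdv
    have := h d hd hdv.1 hdv.2
    unfold Covered NotAllEqual val at *
    rwa [Function.update_of_ne hdv.1, Function.update_of_ne hdv.2]

/-- If neither `x` nor `y` is exempt, the clause forces `x` to be the signed copy of `y` that the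
substitution puts in its place. If one of them is exempt, the merged variable is exempted instead,
at no greater cost. -/
theorem covered_contract {φ : List Pair} {x y : Var} {s t : Bool}
    {A : Var → Bool} {E : Finset Var} (h : ∀ c ∈ ((x, s), (y, t)) :: φ, Covered A E c) :
    ∃ E' : Finset Var, E'.card ≤ E.card ∧
      ∀ c ∈ φ.map (substPair x y (s == t)), Covered A E' c := by
  by_cases hE : x ∈ E ∨ y ∈ E
  · refine ⟨insert y (E.erase x), ?_, ?_⟩
    · by_cases hx : x ∈ E
      · have := Finset.card_erase_add_one hx
        have := Finset.card_insert_le y (E.erase x)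
        omega
      · have hy : y ∈ E := hE.resolve_left hx
        rw [Finset.erase_eq_of_notMem hx, Finset.insert_eq_of_mem hy]
    · simp only [List.forall_mem_map]
      intro c hc
      by_cases h1 : c.1.1 = x
      · left
        simp [substPair, substLit, h1]
      by_cases h2 : c.2.1 = x
      · right; left
        simp [substPair, substLit, h2]
      have := h c (List.mem_cons_of_mem _ hc)
      simp only [substPair, substLit_of_ne h1, substLit_of_ne h2]
      unfold Covered at *
      simp only [Finset.mem_insert, Finset.mem_erase]
      tauto
  · push Not at hE
    refine ⟨E, le_rfl, ?_⟩
    have h0 := h _ (List.mem_cons_self)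
    simp only [Covered, hE.1, hE.2, false_or] at h0
    have hx : xor (A y) (s == t) = A x := by
      unfold NotAllEqual val at h0
      revert h0
      cases A x <;> cases A y <;> cases s <;> cases t <;> simp
    simp only [List.forall_mem_map]
    intro c hc
    have := h c (List.mem_cons_of_mem _ hc)
    unfold Covered at *
    rw [notAllEqual_substPair, hx, Function.update_eq_self]
    rcases this with h1 | h1 | h1
    · left
      have : c.1.1 ≠ x := fun h' => hE.1 (h' ▸ h1)
      simpa [substPair, substLit_of_ne this]
    · right; left
      have : c.2.1 ≠ x := fun h' => hE.1 (h' ▸ h1)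
      simpa [substPair, substLit_of_ne this]
    · exact Or.inr (Or.inr h1)

/-- Undoing a contraction leaves the signs of uninvolved variables unchanged; this transfers all
exempt variables except the merged one. -/
theorem pureIn_cons_of_substPair {φ : List Pair} {x y z : Var} {r : Bool} {c : Pair}
    (hzx : z ≠ x) (hz : PureIn (φ.map (substPair x y r)) z) (h1 : c.1.1 ≠ z) (h2 : c.2.1 ≠ z) :
    PureIn (c :: φ) z := by
  obtain ⟨p, hp⟩ := hz
  refine ⟨p, fun d hd => ?_⟩
  rcases List.mem_cons.1 hd with rfl | hd
  · exact ⟨fun h => absurd h h1, fun h => absurd h h2⟩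
  have := hp _ (List.mem_map_of_mem hd)
  refine ⟨fun h => ?_, fun h => ?_⟩
  · have h3 : d.1.1 ≠ x := h ▸ hzx
    simpa [substPair, substLit_of_ne h3, h] using this.1
  · have h3 : d.2.1 ≠ x := h ▸ hzx
    simpa [substPair, substLit_of_ne h3, h] using this.2

/-- The delicate case is that the merged variable `y` is exempt, with all its occurrences of sign
`p`. Then one of the original variables keeps a single sign even with the restored clause: `y` if `p
= t`, and `x` otherwise. That one is exempted, and the other has at most one further occurrence, so
its value can be adjusted to that clause. -/
theorem covered_uncontract {φ : List Pair} {x y : Var} {s t : Bool} (hxy : x ≠ y)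
    (hx : occ x φ ≤ 1) (hy : occ y φ ≤ 1) {A : Var → Bool} {E : Finset Var}
    (h : ∀ c ∈ φ.map (substPair x y (s == t)), Covered A E c)
    (hE : ∀ z ∈ E, PureIn (φ.map (substPair x y (s == t))) z) :
    ∃ (A' : Var → Bool) (E' : Finset Var), E'.card ≤ E.card ∧
      (∀ c ∈ ((x, s), (y, t)) :: φ, Covered A' E' c) ∧
      ∀ z ∈ E', PureIn (((x, s), (y, t)) :: φ) z := by
  -- After substitution `x` no longer occurs, so exempting it covers nothing.
  wlog hxE : x ∉ E generalizing E
  · have hocc := occ_substPair_self hxy (s == t) φ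
    obtain ⟨A', E', h1, h2⟩ := this (E := E.erase x)
      (fun c hc => by
        obtain ⟨h1, h2⟩ := not_mem_of_occ_eq_zero hocc hc
        have := h c hc
        unfold Covered at *
        simp only [Finset.mem_erase]
        tauto)
      (fun z hz => hE z (Finset.mem_of_mem_erase hz)) (by simp)
    exact ⟨A', E', h1.trans (Finset.card_le_card (Finset.erase_subset _ _)), h2⟩
  have hother : ∀ c ∈ φ, c.1.1 ≠ x → c.2.1 ≠ x → Covered A E c := by
    intro c hc h1 h2
    have := h _ (List.mem_map_of_mem hc)
    rwa [substPair, substLit_of_ne h1, substLit_of_ne h2] at this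
  by_cases hyE : y ∈ E
  swap
  -- The merged variable is not exempt: `x` receives the value that makes the restored clause
  -- not-all-equal.
  · refine ⟨Function.update A x (xor (A y) (s == t)), E, le_rfl, ?_, ?_⟩
    · intro c hc
      rcases List.mem_cons.1 hc with rfl | hc
      · refine Or.inr (Or.inr ?_)
        simp only [NotAllEqual, val, Function.update_self, Function.update_of_ne hxy.symm]
        cases A y <;> cases s <;> cases t <;> decide
      · have key : ∀ l : Lit, (substLit x y (s == t) l).1 ∈ E → l.1 ∈ E := by
          intro l hl
          by_cases h1 : l.1 = x
          · rw [substLit, if_pos h1] at hl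
            exact absurd hl hyE
          · rwa [substLit_of_ne h1] at hl
        rcases h _ (List.mem_map_of_mem hc) with h1 | h1 | h1
        · exact Or.inl (key _ h1)
        · exact Or.inr (Or.inl (key _ h1))
        · exact Or.inr (Or.inr ((notAllEqual_substPair _ _ _ _ _).1 h1))
    · intro z hz
      have hzx : z ≠ x := fun h' => hxE (h' ▸ hz)
      have hzy : z ≠ y := fun h' => hyE (h' ▸ hz)
      exact pureIn_cons_of_substPair hzx (hE z hz) hzx.symm hzy.symm
  obtain ⟨p, hp⟩ := hE y hyE
  have hpy : ∀ c ∈ φ, (c.1.1 = y → c.1.2 = p) ∧ (c.2.1 = y → c.2.2 = p) := by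
    intro c hc
    have := hp _ (List.mem_map_of_mem hc)
    refine ⟨fun h1 => ?_, fun h1 => ?_⟩
    · have h3 : c.1.1 ≠ x := h1 ▸ hxy.symm
      simpa [substPair, substLit_of_ne h3, h1] using this.1
    · have h3 : c.2.1 ≠ x := h1 ▸ hxy.symm
      simpa [substPair, substLit_of_ne h3, h1] using this.2
  have hpx : ∀ c ∈ φ, (c.1.1 = x → xor c.1.2 (s == t) = p) ∧
      (c.2.1 = x → xor c.2.2 (s == t) = p) := by
    intro c hc
    have := hp _ (List.mem_map_of_mem hc)
    refine ⟨fun h1 => ?_, fun h1 => ?_⟩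
    · simpa [substPair, substLit, h1] using this.1
    · simpa [substPair, substLit, h1] using this.2
  -- If the signs agree, `y` stays exempt and covers the restored clause, and `x` is free to serve
  -- its other clause.
  by_cases hpt : p = t
  · obtain ⟨A', hA'⟩ := exists_covered_of_occ_le_one hx hother
    refine ⟨A', E, le_rfl, ?_, ?_⟩
    · intro c hc
      rcases List.mem_cons.1 hc with rfl | hc
      · exact Or.inr (Or.inl hyE)
      · exact hA' c hc
    · intro z hz
      have hzx : z ≠ x := fun h' => hxE (h' ▸ hz)
      by_cases hzy : z = y
      · subst hzy
        refine ⟨p, fun c hc => ?_⟩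
        rcases List.mem_cons.1 hc with rfl | hc
        · exact ⟨fun h' => absurd h' hxy, fun _ => hpt.symm⟩
        · exact hpy c hc
      · exact pureIn_cons_of_substPair hzx (hE z hz) (Ne.symm hzx) (Ne.symm hzy)
  -- Here `y` would occur with both signs, so the exemption passes to `x`, and `y` becomes the free
  -- variable.
  · obtain ⟨A', hA'⟩ := exists_covered_of_occ_le_one (A := A) (E := insert x (E.erase y)) hy
      (fun c hc h1 h2 => by
        by_cases h3 : c.1.1 = x
        · exact Or.inl (by simp [h3])
        by_cases h4 : c.2.1 = x
        · exact Or.inr (Or.inl (by simp [h4]))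
        have := hother c hc h3 h4
        unfold Covered at *
        simp only [Finset.mem_insert, Finset.mem_erase]
        tauto)
    refine ⟨A', insert x (E.erase y), ?_, ?_, ?_⟩
    · have := Finset.card_erase_add_one hyE
      have := Finset.card_insert_le x (E.erase y)
      omega
    · intro c hc
      rcases List.mem_cons.1 hc with rfl | hc
      · exact Or.inl (by simp)
      · exact hA' c hc
    · intro z hz
      rcases Finset.mem_insert.1 hz with rfl | hz
      · refine ⟨s, fun c hc => ?_⟩
        -- An occurrence of `x` with sign `b` became one of `y` with sign `xor b (s == t)`. For `p ≠
        -- t` this forces the sign that `x` has in the restored clause.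
        have key : ∀ b : Bool, xor b (s == t) = p → b = s := by
          revert hpt
          cases p <;> cases s <;> cases t <;> decide
        rcases List.mem_cons.1 hc with rfl | hc
        · exact ⟨fun _ => rfl, fun h' => absurd h'.symm hxy⟩
        · exact ⟨fun h' => key _ ((hpx c hc).1 h'), fun h' => key _ ((hpx c hc).2 h')⟩
      · obtain ⟨hzy, hz⟩ := Finset.mem_erase.1 hz
        have hzx : z ≠ x := fun h' => hxE (h' ▸ hz)
        exact pureIn_cons_of_substPair hzx (hE z hz) (Ne.symm hzx) (Ne.symm hzy)

theorem PureIn.perm {φ ψ : List Pair} (h : φ.Perm ψ) {x : Var} (hx : PureIn φ x) :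
    PureIn ψ x := by
  obtain ⟨s, hs⟩ := hx
  exact ⟨s, fun c hc => hs c (h.mem_iff.2 hc)⟩

/-- Without constants and with at most two occurrences of each variable, `solve` finds the least
number of variables whose clauses are exempt from being not-all-equal. -/
theorem solve_of_occ_le_two : ∀ (k : ℕ) (φ : List Pair), φ.length = k →
    (∀ c ∈ φ, c.1.1 ≠ none ∧ c.2.1 ≠ none) → (∀ z, occ z φ ≤ 2) →
    (solve k φ).2 = 0 ∧
    (∀ A E, (∀ c ∈ φ, Covered A E c) → (solve k φ).1 ≤ E.card) ∧
    ∃ (A : Var → Bool) (E : Finset Var), E.card ≤ (solve k φ).1 ∧ (∀ c ∈ φ, Covered A E c) ∧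
      ∀ z ∈ E, PureIn φ z := by
  intro k
  induction k with
  | zero =>
    intro φ hlen _ _
    obtain rfl := List.length_eq_zero_iff.1 hlen
    exact ⟨rfl, fun _ _ _ => Nat.zero_le _, fun _ => false, ∅, by simp [solve], by simp, by simp⟩
  | succ k ih =>
    intro φ hlen hnone hocc
    obtain ⟨c, ψ, hord⟩ : ∃ c ψ, order φ = c :: ψ := by
      cases h : order φ with
      | nil =>
        have := order_length φ
        rw [h, hlen] at this
        simp at this
      | cons c ψ => exact ⟨c, ψ, rfl⟩
    have hperm : (c :: ψ).Perm φ := hord ▸ order_perm φ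
    have hlen' : ψ.length = k := by
      have := hperm.length_eq
      simp only [List.length_cons, hlen] at this
      omega
    simp only [← hperm.mem_iff] at hnone ⊢
    simp only [← fun z => occ_perm hperm z] at hocc
    suffices hs : (solve (k + 1) φ).2 = 0 ∧
        (∀ A E, (∀ d ∈ c :: ψ, Covered A E d) → (solve (k + 1) φ).1 ≤ E.card) ∧
        ∃ (A : Var → Bool) (E : Finset Var), E.card ≤ (solve (k + 1) φ).1 ∧
          (∀ d ∈ c :: ψ, Covered A E d) ∧ ∀ z ∈ E, PureIn (c :: ψ) z by
      obtain ⟨h1, h2, A, E, h3, h4, h5⟩ := hs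
      exact ⟨h1, h2, A, E, h3, h4, fun z hz => (h5 z hz).perm hperm⟩
    obtain ⟨⟨x, s⟩, ⟨y, t⟩⟩ := c
    obtain ⟨hx, hy⟩ := hnone _ List.mem_cons_self
    have hnone' : ∀ d ∈ ψ, d.1.1 ≠ none ∧ d.2.1 ≠ none :=
      fun d hd => hnone d (List.mem_cons_of_mem _ hd)
    simp only [solve, hord]
    simp only [normalize, if_neg hx, clauseAction, if_neg hy]
    simp only [occ_cons] at hocc
    by_cases hxy : x = y
    · subst hxy
      -- The clause already uses both allowed occurrences of `x`: it is a cycle contracted to a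
      -- loop, isolated from the rest.
      have hocc0 : occ x ψ = 0 := by
        have := hocc x
        simp only [if_true] at this
        omega
      obtain ⟨h1, h2, A, E, h3, h4, h5⟩ := ih ψ hlen' hnone' fun z => by
        have := hocc z
        omega
      by_cases hst : s = t
      · subst hst
        simp only [if_true, map_substPair_of_occ_eq_zero hocc0]
        refine ⟨h1, fun A' E' hc => ?_, A, insert x E, ?_, ?_, ?_⟩
        -- A clause with the same literal twice is never not-all-equal, so every cover exempts `x`.
        -- The other clauses do not use it, so erasing it accounts for exactly the unit of loss.
        · have hxE : x ∈ E' := by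
            simpa [Covered, NotAllEqual] using hc _ List.mem_cons_self
          have := Finset.card_erase_add_one hxE
          have := h2 A' (E'.erase x) fun d hd => by
            obtain ⟨h6, h7⟩ := not_mem_of_occ_eq_zero hocc0 hd
            have := hc d (List.mem_cons_of_mem _ hd)
            unfold Covered at *
            simp only [Finset.mem_erase]
            tauto
          omega
        · have := Finset.card_insert_le x E
          omega
        · intro d hd
          rcases List.mem_cons.1 hd with rfl | hd
          · exact Or.inl (by simp)
          · have := h4 d hd
            unfold Covered at *
            simp only [Finset.mem_insert]
            tauto
        · intro z hz
          by_cases hzx : z = x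
          · subst hzx
            refine ⟨s, fun d hd => ?_⟩
            rcases List.mem_cons.1 hd with rfl | hd
            · exact ⟨fun _ => rfl, fun _ => rfl⟩
            · obtain ⟨h6, h7⟩ := not_mem_of_occ_eq_zero hocc0 hd
              exact ⟨fun h => absurd h h6, fun h => absurd h h7⟩
          · obtain ⟨p, hp⟩ := h5 z (by simpa [hzx] using hz)
            refine ⟨p, fun d hd => ?_⟩
            rcases List.mem_cons.1 hd with rfl | hd
            · exact ⟨fun h => absurd h.symm hzx, fun h => absurd h.symm hzx⟩
            · exact hp d hd
      · simp only [if_true, if_neg hst]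
        -- A clause with both signs of `x` is always not-all-equal. The cover from the induction may
        -- still contain `x`, which now occurs with both signs, so it is erased.
        refine ⟨h1, fun A' E' hc => h2 A' E' fun d hd => hc d (List.mem_cons_of_mem _ hd),
          A, E.erase x, (Finset.card_le_card (Finset.erase_subset _ _)).trans h3, ?_, ?_⟩
        · intro d hd
          rcases List.mem_cons.1 hd with rfl | hd
          · refine Or.inr (Or.inr ?_)
            unfold NotAllEqual val
            revert hst
            cases A x <;> cases s <;> cases t <;> simp
          · obtain ⟨h6, h7⟩ := not_mem_of_occ_eq_zero hocc0 hd
            have := h4 d hd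
            unfold Covered at *
            simp only [Finset.mem_erase]
            tauto
        · intro z hz
          obtain ⟨hzx, hz⟩ := Finset.mem_erase.1 hz
          obtain ⟨p, hp⟩ := h5 z hz
          refine ⟨p, fun d hd => ?_⟩
          rcases List.mem_cons.1 hd with rfl | hd
          · exact ⟨fun h => absurd h.symm hzx, fun h => absurd h.symm hzx⟩
          · exact hp d hd
    · simp only [if_neg hxy]
      have hx1 : occ x ψ ≤ 1 := by
        have := hocc x
        simp only [if_true] at this
        omega
      have hy1 : occ y ψ ≤ 1 := by
        have := hocc y
        simp only [if_true] at this
        omega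
      obtain ⟨h1, h2, A, E, h3, h4, h5⟩ := ih (ψ.map (substPair x y (s == t)))
        (by rw [List.length_map, hlen'])
        (by
          simp only [List.forall_mem_map]
          intro d hd
          have key : ∀ l : Lit, l.1 ≠ none → (substLit x y (s == t) l).1 ≠ none := by
            intro l hl
            unfold substLit
            split_ifs
            exacts [hy, hl]
          exact ⟨key _ (hnone' d hd).1, key _ (hnone' d hd).2⟩)
        (by
          intro z
          by_cases hzx : z = x
          · rw [hzx, occ_substPair_self hxy]
            omega
          by_cases hzy : z = y
          · rw [hzy, occ_substPair_target hxy]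
            omega
          · rw [occ_substPair_other hzx hzy]
            have := hocc z
            omega)
      refine ⟨h1, fun A' E' hc => ?_, ?_⟩
      · obtain ⟨E'', h6, h7⟩ := covered_contract hc
        exact (h2 A' E'' h7).trans h6
      · obtain ⟨A', E', h6, h7, h8⟩ := covered_uncontract hxy hx1 hy1 h4 h5
        exact ⟨A', E', h6.trans h3, h7, h8⟩

/-! ### Covers versus pairs of satisfying assignments -/

/-- When both variables of a clause change value, so do both literals. A clause true before and
after the change then has exactly one true literal each time. -/
theorem Feasible.exists_covered {φ : List Pair} {j : ℕ}
    (hnone : ∀ c ∈ φ, c.1.1 ≠ none ∧ c.2.1 ≠ none) (h : Feasible φ j) :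
    ∃ (A : Var → Bool) (E : Finset Var), E.card ≤ j ∧ ∀ c ∈ φ, Covered A E c := by
  obtain ⟨A₁, A₂, E, hE, -, -, h3, h4, h5⟩ := h
  refine ⟨A₁, E, hE, fun c hc => ?_⟩
  by_cases h6 : c.1.1 ∈ E
  · exact Or.inl h6
  by_cases h7 : c.2.1 ∈ E
  · exact Or.inr (Or.inl h7)
  refine Or.inr (Or.inr ?_)
  have e1 := h5 _ (hnone c hc).1 h6
  have e2 := h5 _ (hnone c hc).2 h7
  have e3 := h3 c hc
  have e4 := h4 c hc
  unfold PairHolds val at *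
  unfold NotAllEqual val
  revert e1 e2 e3 e4
  cases A₁ c.1.1 <;> cases A₁ c.2.1 <;> cases A₂ c.1.1 <;> cases A₂ c.2.1 <;> cases c.1.2 <;>
    cases c.2.2 <;> decide

/-- An exempt variable given its only sign satisfies all its clauses in both assignments. The
remaining clauses are not-all-equal, which survives complementing all other variables. -/
theorem feasible_of_covered {φ : List Pair} (hnone : ∀ c ∈ φ, c.1.1 ≠ none ∧ c.2.1 ≠ none)
    {A : Var → Bool} {E : Finset Var} (h : ∀ c ∈ φ, Covered A E c) (hE : ∀ z ∈ E, PureIn φ z) :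
    Feasible φ E.card := by
  choose! p hp using hE
  let A₁ : Var → Bool := fun z => if z = none then false else if z ∈ E then p z else A z
  let A₂ : Var → Bool := fun z => if z = none then false else if z ∈ E then p z else !A z
  have hlit1 : ∀ c ∈ φ, c.1.1 ∈ E → val A₁ c.1 = true ∧ val A₂ c.1 = true := by
    intro c hc hcE
    have := (hp _ hcE c hc).1 rfl
    simp [val, A₁, A₂, hnone c hc, hcE, this]
  have hlit2 : ∀ c ∈ φ, c.2.1 ∈ E → val A₁ c.2 = true ∧ val A₂ c.2 = true := by
    intro c hc hcE
    have := (hp _ hcE c hc).2 rfl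
    simp [val, A₁, A₂, hnone c hc, hcE, this]
  have hboth : ∀ c ∈ φ, PairHolds A₁ c ∧ PairHolds A₂ c := by
    intro c hc
    by_cases h6 : c.1.1 ∈ E
    · exact ⟨Or.inl (hlit1 c hc h6).1, Or.inl (hlit1 c hc h6).2⟩
    by_cases h7 : c.2.1 ∈ E
    · exact ⟨Or.inr (hlit2 c hc h7).1, Or.inr (hlit2 c hc h7).2⟩
    have := h c hc
    simp only [Covered, h6, h7, false_or] at this
    simp only [PairHolds, val, A₁, A₂, hnone c hc, h6, h7, if_false]
    unfold NotAllEqual val at this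
    revert this
    cases A c.1.1 <;> cases A c.2.1 <;> cases c.1.2 <;> cases c.2.2 <;> decide
  refine ⟨A₁, A₂, E, le_rfl, rfl, rfl, fun c hc => (hboth c hc).1, fun c hc => (hboth c hc).2, ?_⟩
  intro z hz hzE
  simp [A₁, A₂, hz, hzE]

theorem Feasible.mono {φ : List Pair} {i j : ℕ} (h : Feasible φ i) (hij : i ≤ j) :
    Feasible φ j := by
  obtain ⟨A₁, A₂, E, hE, h⟩ := h
  exact ⟨A₁, A₂, E, hE.trans hij, h⟩

/-- The hypothesis of the problem counts clauses, the contraction argument counts occurrences; they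
can be compared once no clause contains a variable twice. -/
theorem occ_le_countP {φ : List Pair} (h : ∀ c ∈ φ, special c = false) (z : Var) :
    occ z φ ≤ φ.countP fun c => decide (c.1.1 = z) || decide (c.2.1 = z) := by
  induction φ with
  | nil => simp
  | cons c φ ih =>
    have h1 := ih fun d hd => h d (List.mem_cons_of_mem _ hd)
    have h2 := h c List.mem_cons_self
    simp only [special, Bool.or_eq_false_iff, decide_eq_false_iff_not] at h2
    rw [occ_cons, List.countP_cons]
    by_cases h3 : c.1.1 = z
    · have h4 : c.2.1 ≠ z := fun h4 => h2.1 (h3.trans h4.symm)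
      simp [h3, h4]
      omega
    · by_cases h4 : c.2.1 = z
      · simp [h3, h4]
        omega
      · simp [h3, h4]
        omega

/-- If every variable is in at most two clauses, then `solve` finds the least number of variables
on which two satisfying assignments agree. -/
theorem feasible_iff_solve : ∀ (k : ℕ) (φ : List Pair), φ.length = k →
    (∀ z ≠ none, (φ.countP fun c => decide (c.1.1 = z) || decide (c.2.1 = z)) ≤ 2) →
    ∀ j, Feasible φ j ↔ (solve k φ).2 = 0 ∧ (solve k φ).1 ≤ j := by
  intro k
  induction k with
  | zero =>
    intro φ hlen _ j
    obtain rfl := List.length_eq_zero_iff.1 hlen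
    have : Feasible [] j := ⟨fun _ => false, fun z => decide (z ≠ none), ∅, by simp⟩
    simp [solve, this]
  | succ k ih =>
    intro φ hlen hdeg j
    obtain ⟨c, ψ, hord⟩ : ∃ c ψ, order φ = c :: ψ := by
      cases h : order φ with
      | nil =>
        have := order_length φ
        rw [h, hlen] at this
        simp at this
      | cons c ψ => exact ⟨c, ψ, rfl⟩
    have hperm : (c :: ψ).Perm φ := hord ▸ order_perm φ
    have hlen' : ψ.length = k := by
      have := hperm.length_eq
      simp only [List.length_cons, hlen] at this
      omega
    simp only [← fun z => hperm.countP_eq (fun c => decide (c.1.1 = z) || decide (c.2.1 = z))]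
      at hdeg
    cases hsp : special c with
    -- No special clause remains, so the not-all-equal analysis applies to the whole formula and no
    -- further induction is needed.
    | false =>
      have hall := special_of_order hord hsp
      have hnone : ∀ d ∈ φ, d.1.1 ≠ none ∧ d.2.1 ≠ none := by
        intro d hd
        have := hall d (hperm.mem_iff.2 hd)
        simp only [special, Bool.or_eq_false_iff, decide_eq_false_iff_not] at this
        exact this.2
      obtain ⟨h1, h2, A, E, h3, h4, h5⟩ := solve_of_occ_le_two (k + 1) φ hlen hnone (by
        intro z
        rw [← occ_perm hperm]
        by_cases hz : z = none
        · subst hz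
          rw [occ_perm hperm]
          have : ∀ l : List Pair, (∀ d ∈ l, d.1.1 ≠ none ∧ d.2.1 ≠ none) → occ none l = 0 := by
            intro l hl
            induction l with
            | nil => rfl
            | cons d l ihl =>
              have h6 := hl d List.mem_cons_self
              rw [occ_cons, ihl fun e he => hl e (List.mem_cons_of_mem _ he), if_neg h6.1,
                if_neg h6.2]
          rw [this φ hnone]
          omega
        · exact (occ_le_countP hall z).trans (hdeg z hz))
      refine ⟨fun h => ⟨h1, ?_⟩, fun h => ?_⟩
      · obtain ⟨A', E', h6, h7⟩ := h.exists_covered hnone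
        exact (h2 A' E' h7).trans h6
      · exact (feasible_of_covered hnone h4 h5).mono (h3.trans h.2)
    | true =>
      have hdegψ : ∀ z ≠ none,
          (ψ.countP fun c => decide (c.1.1 = z) || decide (c.2.1 = z)) ≤ 2 := by
        intro z hz
        refine le_trans ?_ (hdeg z hz)
        rw [List.countP_cons]
        omega
      -- Replacing a variable by a constant creates no occurrences of variables, so the degree bound
      -- passes to the smaller formula.
      have hdegs : ∀ x s, ∀ z ≠ none, ((ψ.map (substPair x none s)).countP
          fun c => decide (c.1.1 = z) || decide (c.2.1 = z)) ≤ 2 := by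
        intro x s z hz
        refine le_trans ?_ (hdegψ z hz)
        rw [List.countP_map]
        refine List.countP_mono_left fun d _ => ?_
        have key : ∀ l : Lit, (substLit x none s l).1 = z → l.1 = z := by
          intro l
          unfold substLit
          split_ifs with h
          · exact fun h' => absurd h'.symm hz
          · exact id
        simp only [Function.comp_apply, substPair, Bool.or_eq_true]
        exact Or.imp (fun h => decide_eq_true (key _ (of_decide_eq_true h)))
          (fun h => decide_eq_true (key _ (of_decide_eq_true h)))
      have hdrop := ih ψ hlen' hdegψ j
      have hsub := fun x s => ih (ψ.map (substPair x none s)) (by rw [List.length_map, hlen'])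
        (hdegs x s) (j - 1)
      have hunit : ∀ x s, (1 ≤ j ∧ Feasible (ψ.map (substPair x none s)) (j - 1)) ↔
          (solve k (ψ.map (substPair x none s))).2 = 0 ∧
          (solve k (ψ.map (substPair x none s))).1 + 1 ≤ j := by
        intro x s
        rw [hsub]
        omega
      rw [← Feasible.perm hperm]
      simp only [solve, hord]
      have hnormal : Feasible (c :: ψ) j ↔ Feasible (normalize c :: ψ) j := by
        have : ∀ A, PairHolds A (normalize c) ↔ PairHolds A c := by
          intro A
          unfold normalize PairHolds
          split_ifs
          exacts [or_comm, Iff.rfl]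
        simp only [Feasible, List.forall_mem_cons, this]
      -- Normalization leaves only these cases: a constant in second place, or the same variable
      -- twice.
      have hsp' : special (normalize c) = true ∧
          ((normalize c).1.1 = none → (normalize c).2.1 = none) := by
        unfold normalize
        split_ifs with h
        · simp [special, h]
        · exact ⟨hsp, fun h' => absurd h' h⟩
      rw [hnormal]
      generalize normalize c = c' at hsp'
      obtain ⟨⟨x, s⟩, ⟨y, t⟩⟩ := c'
      obtain ⟨hsp1, hsp2⟩ := hsp'
      simp only [special, Bool.or_eq_true, decide_eq_true_eq] at hsp1 hsp2
      simp only [clauseAction]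
      by_cases hy : y = none
      · subst hy
        cases t with
        | false =>
          rw [feasible_cons_of_holds (fun A hA => Or.inr (by simp [val, hA]))]
          simpa using hdrop
        | true =>
          by_cases hx : x = none
          · subst hx
            cases s with
            | true =>
              have := not_feasible_cons (c := ((none, true), (none, true))) (φ := ψ)
                (fun A hA => by simp [PairHolds, val, hA]) j
              simp [this]
            | false =>
              rw [feasible_cons_of_holds (fun A hA => Or.inl (by simp [val, hA]))]
              simpa using hdrop
          · rw [feasible_cons_unit hx (s := s) (fun A hA => by simp [PairHolds, val, hA]), hunit]
            simp [hx]
      · have hx : x ≠ none := fun h => hy (hsp2 h)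
        have hxy : x = y := by tauto
        subst hxy
        by_cases hst : s = t
        · subst hst
          rw [feasible_cons_unit hx (s := s) (fun A hA => by simp [PairHolds, val]), hunit]
          simp [hx]
        · rw [feasible_cons_of_holds (fun A hA => by
            unfold PairHolds val
            revert hst
            cases A x <;> cases s <;> cases t <;> simp)]
          simpa [hx, hst] using hdrop

/-! ### Reduction of the problem to `solve` -/

/-- The literal of a formula, as a literal over variables and constants. -/
def liftLit (l : Literal) : Lit := (some l.1, l.2)

/-- A clause with at most two literals, filled up with the constant `false`. -/
def toPair : Clause → Pair
  | [] => ((none, true), (none, true))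
  | [l] => (liftLit l, (none, true))
  | l :: l' :: _ => (liftLit l, liftLit l')

/-- The literals of a list of clauses. -/
def literals (φ : List Pair) : List Lit := φ.flatMap fun c => [c.1, c.2]

/-- The number of different variables in a list of literals: each variable met is counted and
replaced by a constant in the rest of the list. -/
def distinctVars : ℕ → List Lit → ℕ
  | 0, _ => 0
  | _ + 1, [] => 0
  | k + 1, l :: ls =>
    if l.1 = none then distinctVars k ls
    else distinctVars k (ls.map (substLit l.1 none l.2)) + 1

theorem distinctVars_eq : ∀ (k : ℕ) (ls : List Lit), ls.length = k →
    distinctVars k ls = ((ls.map Prod.fst).toFinset.erase none).card := by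
  intro k
  induction k with
  | zero =>
    intro ls h
    obtain rfl := List.length_eq_zero_iff.1 h
    rfl
  | succ k ih =>
    intro ls h
    cases ls with
    | nil => simp at h
    | cons l ls =>
      simp only [List.length_cons, Nat.add_right_cancel_iff] at h
      unfold distinctVars
      split_ifs with hl
      · rw [ih ls h, List.map_cons, List.toFinset_cons, hl, Finset.erase_insert_eq_erase]
      · rw [ih _ (by rwa [List.length_map])]
        have hmem : l.1 ∈ ((l :: ls).map Prod.fst).toFinset.erase none := by simp [hl]
        rw [← Finset.card_erase_add_one hmem]
        congr 2
        ext z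
        simp only [List.map_map, Finset.mem_erase, List.mem_toFinset, List.mem_map,
          Function.comp_apply, List.map_cons, List.mem_cons]
        constructor
        · rintro ⟨hz, e, he, rfl⟩
          unfold substLit at hz ⊢
          split_ifs at hz ⊢ with h1
          · exact absurd rfl hz
          · exact ⟨h1, hz, Or.inr ⟨e, he, rfl⟩⟩
        · rintro ⟨hzl, hz, hzl' | ⟨e, he, rfl⟩⟩
          · exact absurd hzl' hzl
          · exact ⟨hz, e, he, by rw [substLit_of_ne hzl]⟩

theorem vars_toPair {φ : CNF} (h : IsTwoCNF φ) :
    ((literals (φ.map toPair)).map Prod.fst).toFinset.erase none =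
      φ.vars.map Function.Embedding.some := by
  ext z
  simp only [literals, CNF.vars, Finset.mem_erase, List.mem_toFinset, List.mem_map,
    List.mem_flatMap, Finset.mem_map, Function.Embedding.some_apply]
  constructor
  · rintro ⟨hz, l, ⟨_, ⟨C, hC, rfl⟩, hl⟩, rfl⟩
    rcases C with _ | ⟨a, _ | ⟨b, C⟩⟩
    · simp [toPair] at hl
      simp [hl] at hz
    · simp only [toPair, List.mem_cons, List.not_mem_nil, or_false] at hl
      rcases hl with rfl | rfl
      · exact ⟨a.1, ⟨_, hC, a, by simp, rfl⟩, rfl⟩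
      · simp at hz
    · simp only [toPair, List.mem_cons, List.not_mem_nil, or_false] at hl
      rcases hl with rfl | rfl
      · exact ⟨a.1, ⟨_, hC, a, by simp, rfl⟩, rfl⟩
      · exact ⟨b.1, ⟨_, hC, b, by simp, rfl⟩, rfl⟩
  · rintro ⟨x, ⟨C, hC, l, hl, rfl⟩, rfl⟩
    refine ⟨by simp, liftLit l, ⟨_, ⟨C, hC, rfl⟩, ?_⟩, rfl⟩
    have := h C hC
    rcases C with _ | ⟨a, _ | ⟨b, _ | ⟨c, C⟩⟩⟩
    · simp at hl
    · simp at hl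
      simp [toPair, hl]
    · simp at hl
      rcases hl with rfl | rfl <;> simp [toPair]
    · simp at this

theorem pairHolds_toPair {C : Clause} (h : C.length ≤ 2) {A : Var → Bool} (hA : A none = false) :
    PairHolds A (toPair C) ↔ ∃ l ∈ C, A (some l.1) = l.2 := by
  rcases C with _ | ⟨a, _ | ⟨b, _ | ⟨c, C⟩⟩⟩
  · simp [toPair, PairHolds, val, hA]
  · simp [toPair, PairHolds, val, hA, liftLit]
  · simp [toPair, PairHolds, val, liftLit]
  · simp at h

theorem countP_toPair_le {φ : CNF} (h : IsTwoTwoCNF φ) (z : Var) (hz : z ≠ none) :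
    ((φ.map toPair).countP fun c => decide (c.1.1 = z) || decide (c.2.1 = z)) ≤ 2 := by
  obtain ⟨x, rfl⟩ := Option.ne_none_iff_exists'.1 hz
  refine le_trans ?_ (h.2 x)
  rw [List.countP_map]
  refine List.countP_mono_left fun C hC => ?_
  simp only [Function.comp_apply, Bool.or_eq_true, decide_eq_true_eq]
  rcases C with _ | ⟨a, _ | ⟨b, C⟩⟩
  · simp [toPair]
  · simp [toPair, Clause.vars, liftLit, eq_comm]
  · intro h
    simp only [toPair, liftLit, Option.some.injEq] at h
    rcases h with h | h <;> simp [Clause.vars, ← h]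

/-- On the variables of `φ`, agreeing on at most `j` and differing on at least `n - j` are the same,
written without truncated subtraction. -/
theorem feasible_toPair_iff {φ : CNF} (h : IsTwoCNF φ) (j : ℕ) :
    Feasible (φ.map toPair) j ↔ ∃ σ₁ σ₂ : Assignment, Satisfies σ₁ φ ∧ Satisfies σ₂ φ ∧
      φ.vars.card ≤ (differSet φ σ₁ σ₂).card + j := by
  have hsat : ∀ A : Var → Bool, A none = false →
      ((∀ c ∈ φ.map toPair, PairHolds A c) ↔ Satisfies (fun x => A (some x)) φ) := by
    intro A hA
    simp only [List.forall_mem_map, Satisfies]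
    exact forall₂_congr fun C hC => pairHolds_toPair (h C hC) hA
  constructor
  · rintro ⟨A₁, A₂, E, hE, h1, h2, h3, h4, h5⟩
    refine ⟨fun x => A₁ (some x), fun x => A₂ (some x), (hsat _ h1).1 h3, (hsat _ h2).1 h4, ?_⟩
    unfold differSet
    rw [← Finset.card_filter_add_card_filter_not (s := φ.vars)
      (p := fun x => A₁ (some x) ≠ A₂ (some x))]
    refine Nat.add_le_add_left (le_trans ?_ hE) _
    refine Finset.card_le_card_of_injOn some ?_ (Option.some_injective _).injOn
    intro x hx
    simp only [Finset.coe_filter, Set.mem_ofPred_eq, ne_eq, not_not] at hx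
    by_contra hxE
    exact h5 (some x) (by simp) hxE hx.2
  · rintro ⟨σ₁, σ₂, h1, h2, h3⟩
    let A₁ : Var → Bool := fun z => z.elim false σ₁
    -- `Feasible` asks for disagreement on every variable outside a finite set, so the infinitely
    -- many variables absent from `φ` are made to differ.
    let A₂ : Var → Bool := fun z => z.elim false fun x => if x ∈ φ.vars then σ₂ x else !σ₁ x
    refine ⟨A₁, A₂, (φ.vars.filter fun x => ¬ σ₁ x ≠ σ₂ x).map Function.Embedding.some, ?_, rfl, rfl,
      (hsat A₁ rfl).2 h1, (hsat A₂ rfl).2 ?_, ?_⟩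
    · rw [Finset.card_map]
      have := Finset.card_filter_add_card_filter_not (s := φ.vars) (p := fun x => σ₁ x ≠ σ₂ x)
      unfold differSet at h3
      omega
    · intro C hC
      obtain ⟨l, hl, hσ⟩ := h2 C hC
      refine ⟨l, hl, ?_⟩
      have : l.1 ∈ φ.vars := by
        simp only [CNF.vars, List.mem_toFinset, List.mem_flatMap, List.mem_map]
        exact ⟨C, hC, l, hl, rfl⟩
      simp [A₂, this, hσ]
    · rintro (_ | x) hx hxE
      · exact absurd rfl hx
      · by_cases hxv : x ∈ φ.vars
        · simpa [A₁, A₂, hxv] using hxE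
        · simp [A₁, A₂, hxv]

/-! ### Comparison with a binary number and the decision criterion -/

/-- The value of a list of bits, the least significant first. -/
def bitsValue : List Bool → ℕ
  | [] => 0
  | b :: s => b.toNat + 2 * bitsValue s

theorem bitsValue_encodeNat (d : ℕ) : bitsValue (Computability.encodeNat d) = d := by
  have hpos : ∀ n : PosNum, bitsValue (Computability.encodePosNum n) = n := by
    intro n
    induction n with
    | one => rfl
    | bit0 n ih => simp [Computability.encodePosNum, bitsValue, ih, PosNum.cast_bit0]; omega
    | bit1 n ih => simp [Computability.encodePosNum, bitsValue, ih, PosNum.cast_bit1]; omega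
  unfold Computability.encodeNat
  conv_rhs => rw [← Num.to_of_nat d]
  generalize (d : Num) = e
  cases e with
  | zero => rfl
  | pos n => exact hpos n

/-- The number of times the subtraction of a number in binary from `n`, bit by bit, fails. -/
def overflow : List Bool → ℕ → ℕ
  | [], _ => 0
  | false :: s, n => overflow s (n / 2)
  | true :: s, n => (if n = 0 then 1 else 0) + overflow s ((n - 1) / 2)

/-- For a bit `b`, `b + 2 * v ≤ n` holds iff `b ≤ n` and `v ≤ (n - b) / 2`. After a failure the
total is positive, whatever the later bits do. -/
theorem overflow_eq_zero_iff (s : List Bool) (n : ℕ) : overflow s n = 0 ↔ bitsValue s ≤ n := by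
  induction s generalizing n with
  | nil => simp [overflow, bitsValue]
  | cons b s ih =>
    cases b with
    | false =>
      simp only [overflow, bitsValue, ih, Bool.toNat_false]
      omega
    | true =>
      by_cases hn : n = 0
      · simp [overflow, bitsValue, hn]
      · simp only [overflow, bitsValue, ih, Bool.toNat_true, if_neg hn, zero_add]
        omega

/-- The number of failures of the decision procedure. -/
def failures (I : Instance) : ℕ :=
  (solve I.1.length (I.1.map toPair)).2 + overflow (Computability.encodeNat I.2)
    (distinctVars (2 * I.1.length) (literals (I.1.map toPair)) -
      (solve I.1.length (I.1.map toPair)).1)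

theorem literals_length (φ : List Pair) : (literals φ).length = 2 * φ.length := by
  induction φ with
  | nil => rfl
  | cons c φ ih =>
    simp only [literals, List.flatMap_cons, List.length_append, List.length_cons] at ih ⊢
    simp only [ih, List.length_nil]
    omega

theorem failures_eq_zero_iff {I : Instance} (h : IsTwoTwoCNF I.1) :
    failures I = 0 ↔ IsYes I := by
  obtain ⟨φ, d⟩ := I
  have hn : distinctVars (2 * φ.length) (literals (φ.map toPair)) = φ.vars.card := by
    rw [distinctVars_eq _ _ (by rw [literals_length, List.length_map]), vars_toPair h.1,
      Finset.card_map]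
  have key := feasible_iff_solve φ.length (φ.map toPair) (by simp) (countP_toPair_le h)
  simp only [feasible_toPair_iff h.1] at key
  simp only [failures, hn, Nat.add_eq_zero_iff, overflow_eq_zero_iff, bitsValue_encodeNat, IsYes]
  generalize solve φ.length (φ.map toPair) = r at key
  constructor
  · rintro ⟨h1, h2⟩
    -- The computed loss is itself an attainable number of agreements, which yields an optimal pair.
    obtain ⟨σ₁, σ₂, h3, h4, h5⟩ := (key r.1).2 ⟨h1, le_rfl⟩
    exact ⟨σ₁, σ₂, h3, h4, by omega⟩
  · rintro ⟨σ₁, σ₂, h3, h4, h5⟩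
    have hle : (differSet φ σ₁ σ₂).card ≤ φ.vars.card := Finset.card_filter_le _ _
    obtain ⟨h1, h2⟩ := (key (φ.vars.card - (differSet φ σ₁ σ₂).card)).1
      ⟨σ₁, σ₂, h3, h4, by omega⟩
    exact ⟨h1, by omega⟩

/-! ### Programs: basic operations -/

theorem Run.to {p : Prog} {m m' m'' : Mem} {a b : ℕ} (h : Run p m a m') (hm : m' = m'')
    (hab : a ≤ b) : Run p m b m'' :=
  hm ▸ h.mono hab

theorem Run.to' {p : Prog} {m m' m'' : Mem} {a : ℕ} (h : Run p m a m'') (hm : m' = m) :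
    Run p m' a m'' :=
  hm ▸ h

theorem Run.case_of {k j : Reg} {f : Option Sym → Option Sym → Prog} {m m' : Mem} {n : ℕ}
    (a b : Option Sym) (ha : (m.get k).head? = a) (hb : (m.get j).head? = b)
    (h : Run (f a b) m n m') : Run (.case k j f) m (n + 1) m' :=
  Run.case (by rwa [ha, hb])

/-- Any symbol. -/
def anySym : Option Sym → Bool
  | some _ => true
  | none => false

/-- A symbol of the name of a variable or constant. -/
def inName : Option Sym → Bool
  | some (.bit _) => true
  | some .clause => true
  | _ => false

/-- A binary digit. -/
def isBit : Option Sym → Bool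
  | some (.bit _) => true
  | _ => false

namespace Prog

/-- Move one symbol from `i` to `j`. -/
def moveOne (i j : Reg) : Prog :=
  .case i i fun a _ =>
    match a with
    | some a => .pop i ;; .push j a
    | none => .nop

/-- Move symbols from `i` to `j` as long as they satisfy `c`. -/
def move (c : Option Sym → Bool) (i j : Reg) : Prog := .loop i i (fun a _ => c a) (moveOne i j)

/-- Move all symbols from `i` to both `j` and `k`. -/
def fork (i j k : Reg) : Prog :=
  .loop i i (fun a _ => anySym a) (.case i i fun a _ =>
    match a with
    | some a => .pop i ;; .push j a ;; .push k a
    | none => .nop)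

/-- Remove symbols from `i` as long as they satisfy `c`. -/
def clear (c : Option Sym → Bool) (i : Reg) : Prog := .loop i i (fun a _ => c a) (.pop i)

end Prog

theorem run_moveOne {i j : Reg} (hij : i ≠ j) {m : Mem} {a : Sym} {r : List Sym}
    (h : m.get i = a :: r) :
    Run (.moveOne i j) m 3 ((m.set i r).set j (a :: m.get j)) := by
  refine Run.case_of (some a) (some a) (by rw [h]; rfl) (by rw [h]; rfl) ?_
  refine ((Run.pop i m).seq (Run.push j a _)).to ?_ le_rfl
  rw [h, Mem.get_set_of_ne _ hij.symm]
  rfl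

/-- A move reverses the word, which is why words travel through an auxiliary stack and moves come in
pairs. -/
theorem run_move {c : Option Sym → Bool} {i j : Reg} (hij : i ≠ j) {m : Mem} (u r : List Sym)
    (h : m.get i = u ++ r) (hu : ∀ a ∈ u, c (some a) = true) (hr : c r.head? = false) :
    Run (.move c i j) m (4 * u.length + 1) ((m.set i r).set j (u.reverse ++ m.get j)) := by
  induction u generalizing m with
  | nil =>
    refine (Run.loop_done (by rw [h]; exact hr)).to ?_ (by simp)
    rw [List.nil_append] at h
    rw [← h, Mem.set_get, List.reverse_nil, List.nil_append, Mem.set_get]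
  | cons a u ih =>
    have h1 := run_moveOne hij h
    have h2 := ih (m := (m.set i (u ++ r)).set j (a :: m.get j))
      (by rw [Mem.get_set_of_ne _ hij, Mem.get_set_self]) (fun b hb => hu b (by simp [hb]))
    refine (Run.loop_step (by rw [h]; exact hu a (by simp)) h1 h2).to ?_
      (by rw [List.length_cons]; omega)
    rw [Mem.get_set_self, Mem.set_comm _ hij.symm, Mem.set_set, Mem.set_set]
    simp

theorem run_move_all {i j : Reg} (hij : i ≠ j) {m : Mem} {s : List Sym} (h : m.get i = s) :
    Run (.move anySym i j) m (4 * s.length + 1) ((m.set i []).set j (s.reverse ++ m.get j)) :=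
  run_move hij s [] (by rw [h, List.append_nil]) (fun _ _ => rfl) rfl

theorem run_fork {i j k : Reg} (hij : i ≠ j) (hik : i ≠ k) (hjk : j ≠ k) {m : Mem} {s : List Sym}
    (h : m.get i = s) :
    Run (.fork i j k) m (5 * s.length + 1)
      (((m.set i []).set j (s.reverse ++ m.get j)).set k (s.reverse ++ m.get k)) := by
  induction s generalizing m with
  | nil =>
    refine (Run.loop_done (by rw [h]; rfl)).to ?_ (by simp)
    rw [← h, Mem.set_get, h, List.reverse_nil, List.nil_append, Mem.set_get, List.nil_append,
      Mem.set_get]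
  | cons a s ih =>
    have h1 : Run (.case i i fun a _ =>
        match a with
        | some a => .pop i ;; .push j a ;; .push k a
        | none => .nop) m 4 (((m.set i s).set j (a :: m.get j)).set k (a :: m.get k)) := by
      refine Run.case_of (some a) (some a) (by rw [h]; rfl) (by rw [h]; rfl) ?_
      refine ((Run.pop i m).seq ((Run.push j a _).seq (Run.push k a _))).to ?_ le_rfl
      rw [h, Mem.get_set_of_ne _ hij.symm, Mem.get_set_of_ne _ hjk.symm,
        Mem.get_set_of_ne _ hik.symm]
      rfl
    have h2 := ih (m := ((m.set i s).set j (a :: m.get j)).set k (a :: m.get k))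
      (by rw [Mem.get_set_of_ne _ hik, Mem.get_set_of_ne _ hij, Mem.get_set_self])
    refine (Run.loop_step (by rw [h]; rfl) h1 h2).to ?_ (by rw [List.length_cons]; omega)
    apply Mem.ext_get
    intro l
    simp only [Mem.get_set, hjk, hjk.symm, hij.symm, hik.symm, if_true, if_false]
    split_ifs <;> simp

theorem run_clear {c : Option Sym → Bool} {i : Reg} {m : Mem} (u r : List Sym)
    (h : m.get i = u ++ r) (hu : ∀ a ∈ u, c (some a) = true) (hr : c r.head? = false) :
    Run (.clear c i) m (2 * u.length + 1) (m.set i r) := by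
  induction u generalizing m with
  | nil =>
    refine (Run.loop_done (by rw [h]; exact hr)).to ?_ (by simp)
    rw [List.nil_append] at h
    rw [← h, Mem.set_get]
  | cons a u ih =>
    have h2 := ih (m := m.set i (u ++ r)) (by rw [Mem.get_set_self])
      (fun b hb => hu b (by simp [hb]))
    refine (Run.loop_step (by rw [h]; exact hu a (by simp))
      ((Run.pop i m).to (by rw [h]; rfl) le_rfl) h2).to ?_ (by rw [List.length_cons]; omega)
    rw [Mem.set_set]

theorem run_clear_all {i : Reg} {m : Mem} {s : List Sym} (h : m.get i = s) :
    Run (.clear anySym i) m (2 * s.length + 1) (m.set i []) :=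
  run_clear s [] (by rw [h, List.append_nil]) (fun _ _ => rfl) rfl

/-! ### Comparison of names -/

/-- Push a mark on `B` if the name on top of `F` is the one on `X`. -/
def Prog.compareName : Prog :=
  .loop .F .X (fun a b => inName a && decide (a = b)) (.case .F .F fun a _ =>
    match a with
    | some a => .pop .F ;; .pop .X ;; .push .T a
    | none => .nop) ;;
  .case .F .X (fun a b => if inName a = false ∧ b = none then .push .B .clause else .nop) ;;
  .fork .T .F .X

theorem run_compareName {m : Mem} (u v r : List Sym) (hF : m.F = u ++ r) (hX : m.X = v)
    (hT : m.T = []) (hu : ∀ a ∈ u, inName (some a) = true) (hr : inName r.head? = false) :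
    Run .compareName m (10 * u.length + 5)
      { m with B := if u = v then .clause :: m.B else m.B } := by
  -- The loop strips the common prefix `p` of both names. They are equal iff nothing of either is
  -- left; on `F` this shows as a top symbol, if any, that belongs to no name.
  have key : ∀ (u v : List Sym) (m : Mem), m.F = u ++ r → m.X = v →
      (∀ a ∈ u, inName (some a) = true) →
      ∃ p u' v', u = p ++ u' ∧ v = p ++ v' ∧
        ((inName (u' ++ r).head? = false ∧ v'.head? = none) ↔ u = v) ∧
        Run (.loop .F .X (fun a b => inName a && decide (a = b)) (.case .F .F fun a _ =>
          match a with
          | some a => .pop .F ;; .pop .X ;; .push .T a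
          | none => .nop)) m (5 * p.length + 1)
          { m with F := u' ++ r, X := v', T := p.reverse ++ m.T } := by
    intro u
    induction u with
    | nil =>
      intro v m hF hX _
      refine ⟨[], [], v, rfl, rfl, ?_, ?_⟩
      · cases v <;> simp [hr]
      · refine (Run.loop_done ?_).to ?_ (by simp)
        · simp only [Mem.get, hF, List.nil_append, hr, Bool.false_and]
        · rw [← hX, ← hF]; rfl
    | cons a u ih =>
      intro v m hF hX hu
      by_cases hva : v.head? = some a
      · obtain ⟨v, rfl⟩ : ∃ w, v = a :: w := by
          cases v with
          | nil => simp at hva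
          | cons b v => simp at hva; exact ⟨v, by rw [hva]⟩
        obtain ⟨p, u', v', rfl, rfl, h1, h2⟩ := ih v
          { m with F := u ++ r, X := v, T := a :: m.T } rfl rfl
          (fun b hb => hu b (by simp [hb]))
        refine ⟨a :: p, u', v', rfl, rfl, by simpa using h1, ?_⟩
        have h3 : Run (.case .F .F fun a _ =>
            match a with
            | some a => .pop .F ;; .pop .X ;; .push .T a
            | none => .nop) m 4
            { m with F := p ++ u' ++ r, X := p ++ v', T := a :: m.T } := by
          refine Run.case_of (some a) (some a) (by simp [Mem.get, hF]) (by simp [Mem.get, hF]) ?_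
          refine ((Run.pop _ _).seq ((Run.pop _ _).seq (Run.push _ _ _))).to ?_ le_rfl
          simp [Mem.get, Mem.set, hF, hX]
        refine (Run.loop_step ?_ h3 h2).to ?_ ?_
        · simp [Mem.get, hF, hX, hu]
        · simp
        · rw [List.length_cons]
          omega
      · refine ⟨[], a :: u, v, rfl, rfl, ?_, ?_⟩
        · simp only [List.cons_append, List.head?_cons, hu a (by simp)]
          constructor
          · rintro ⟨h, -⟩
            cases h
          · rintro rfl
            simp at hva
        · refine (Run.loop_done ?_).to ?_ (by simp)
          · simp only [Mem.get, hF, hX, List.cons_append, List.head?_cons, Bool.and_eq_false_iff,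
              decide_eq_false_iff_not]
            exact Or.inr fun h => hva h.symm
          · rw [← hX, ← hF]; rfl
  obtain ⟨p, u', v', hu', hv', h1, h2⟩ := key u v m hF hX hu
  have hlen : p.length ≤ u.length := by rw [hu']; simp
  have h3 : Run (.case .F .X
      (fun a b => if inName a = false ∧ b = none then .push .B .clause else .nop))
      { m with F := u' ++ r, X := v', T := p.reverse ++ m.T } 2
      { m with F := u' ++ r, X := v', T := p.reverse ++ m.T,
               B := if u = v then .clause :: m.B else m.B } := by
    refine Run.case_of (u' ++ r).head? v'.head? rfl rfl ?_
    by_cases huv : u = v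
    · rw [if_pos (h1.2 huv), if_pos huv]
      exact Run.push _ _ _
    · rw [if_neg fun h => huv (h1.1 h), if_neg huv]
      exact Run.nop _
  -- The fork puts the common prefix back on both stacks, so the comparison destroys neither name.
  refine (h2.seq (h3.seq (run_fork (by decide) (by decide) (by decide) rfl))).to ?_ ?_
  · simp [Mem.get, Mem.set, hT, hF, hX, hu', hv']
  · simp [Mem.get, hT]
    omega

/-! ### Words for literals -/

/-- The name of a variable or constant. -/
def nameWord : Var → List Sym
  | none => [.clause]
  | some x => encodeNum x

/-- The word of a literal. -/
def litWord (l : Lit) : List Sym := .sign l.2 :: nameWord l.1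

/-- The word of a list of literals. -/
def litsWord (ls : List Lit) : List Sym := ls.flatMap litWord

@[simp] theorem litsWord_nil : litsWord [] = [] := rfl

@[simp] theorem litsWord_cons (l : Lit) (ls : List Lit) :
    litsWord (l :: ls) = .sign l.2 :: (nameWord l.1 ++ litsWord ls) := rfl

@[simp] theorem litsWord_append (ls ls' : List Lit) :
    litsWord (ls ++ ls') = litsWord ls ++ litsWord ls' := List.flatMap_append

theorem encodeNum_injective : Function.Injective encodeNum := by
  intro a b h
  refine (encodeNum_append_inj (s := []) (t := []) (by simp) (by simp) ?_).1
  rw [h]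

/-- The constant is written with a symbol that is not a bit, so it cannot be confused with a
variable. Comparing words therefore compares variables. -/
theorem nameWord_eq_iff {u v : Var} : nameWord u = nameWord v ↔ u = v := by
  refine ⟨fun h => ?_, congrArg _⟩
  have hne : ∀ x, encodeNum x ≠ [.clause] := by
    intro x hx
    have : Sym.clause ∈ encodeNum x := by simp [hx]
    simp [encodeNum] at this
  cases u with
  | none =>
    cases v with
    | none => rfl
    | some y => exact absurd h.symm (hne y)
  | some x =>
    cases v with
    | none => exact absurd h (hne x)
    | some y => rw [encodeNum_injective h]

theorem isBit_of_mem_encodeNum {x : ℕ} {a : Sym} (h : a ∈ encodeNum x) :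
    isBit (some a) = true := by
  simp only [encodeNum, List.mem_map] at h
  obtain ⟨b, -, rfl⟩ := h
  rfl

theorem inName_of_mem_nameWord {v : Var} {a : Sym} (h : a ∈ nameWord v) :
    inName (some a) = true := by
  cases v with
  | none =>
    simp only [nameWord, List.mem_singleton] at h
    rw [h]
    rfl
  | some x =>
    have := isBit_of_mem_encodeNum h
    cases a <;> simp_all [isBit, inName]

theorem inName_head_litsWord (ls : List Lit) : inName (litsWord ls).head? = false := by
  cases ls <;> rfl

theorem head_nameWord_eq_clause_iff (v : Var) :
    (nameWord v).head? = some .clause ↔ v = none := by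
  cases v with
  | none => simp [nameWord]
  | some x =>
    simp only [reduceCtorEq, iff_false]
    intro h
    have := isBit_of_mem_encodeNum (List.mem_of_head? h)
    simp [isBit] at this

/-- All names in a list of literals have length at most `w`. -/
def Narrow (w : ℕ) (ls : List Lit) : Prop := ∀ l ∈ ls, (nameWord l.1).length ≤ w

theorem length_litsWord_le {w : ℕ} {ls : List Lit} (h : Narrow w ls) :
    (litsWord ls).length ≤ ls.length * (w + 1) := by
  induction ls with
  | nil => simp
  | cons l ls ih =>
    have h1 := ih fun l hl => h l (List.mem_cons_of_mem _ hl)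
    have h2 := h l List.mem_cons_self
    simp only [litsWord_cons, List.length_cons, List.length_append, Nat.succ_mul (List.length _)]
    omega

/-- Substitution copies a name without building longer ones, so one width bound serves all rounds.
-/
theorem Narrow.substLit {w : ℕ} {ls : List Lit} (h : Narrow w ls) {x y : Var} (r : Bool)
    (hy : (nameWord y).length ≤ w) : Narrow w (ls.map (substLit x y r)) := by
  simp only [Narrow, List.forall_mem_map]
  intro l hl
  unfold MaxDiffer.substLit
  split_ifs
  exacts [hy, h l hl]

/-! ### Substitution -/

namespace Prog

/-- Move the literal with sign `b` and the name on top of `F` to `G`; the variable on `X` is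
replaced by the one on `Y`, with the opposite sign if `S` and `W` have the same top. -/
def replaceLit (b : Bool) : Prog :=
  .compareName ;; .case .B .B fun a _ =>
    if a = none then .push .G (.sign b) ;; .move inName .F .G
    else .pop .B ;; .clear inName .F ;;
      .case .S .W (fun s t => .push .G (.sign (xor b (decide (s = t))))) ;;
      .fork .Y .G .T ;; .move anySym .T .Y

/-- Replace a variable in all literals on `F`. -/
def substitute : Prog :=
  .loop .F .F (fun a _ => anySym a) (.case .F .F fun a _ =>
    match a with
    | some (.sign b) => .pop .F ;; replaceLit b
    | _ => .nop) ;;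
  .move anySym .G .F

end Prog

theorem run_replaceLit {m : Mem} {x y v : Var} {s t b : Bool} {ls : List Lit} {w : ℕ}
    (hF : m.F = nameWord v ++ litsWord ls) (hX : m.X = nameWord x) (hY : m.Y = nameWord y)
    (hS : m.S = [.sign s]) (hW : m.W = [.sign t]) (hT : m.T = []) (hB : m.B = [])
    (hv : (nameWord v).length ≤ w) (hy : (nameWord y).length ≤ w) :
    Run (.replaceLit b) m (21 * w + 20)
      { m with F := litsWord ls, G := (litWord (substLit x y (s == t) (v, b))).reverse ++ m.G } := by
  have h1 := run_compareName (nameWord v) (nameWord x) (litsWord ls) hF hX hT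
    (fun _ => inName_of_mem_nameWord) (inName_head_litsWord ls)
  simp only [nameWord_eq_iff, hB] at h1
  by_cases hvx : v = x
  · rw [if_pos hvx] at h1
    refine Run.to (h1.seq (Run.case_of (some .clause) (some .clause) rfl rfl (Run.seq (Run.pop _ _)
      (Run.seq (run_clear (nameWord v) (litsWord ls) hF (fun _ => inName_of_mem_nameWord)
        (inName_head_litsWord ls))
      (Run.seq (Run.case_of (some (.sign s)) (some (.sign t)) (by simp [Mem.get, Mem.set, hS])
        (by simp [Mem.get, Mem.set, hW]) (Run.push _ _ _))
      (Run.seq (run_fork (by decide) (by decide) (by decide) (s := nameWord y) hY)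
      (run_move_all (by decide) rfl))))))) ?_ ?_
    · simp [Mem.get, Mem.set, hF, hX, hY, hS, hW, hT, hB, substLit, hvx, litWord]
      cases s <;> cases t <;> rfl
    · simp [Mem.get, Mem.set, hT]
      omega
  · rw [if_neg hvx] at h1
    refine Run.to (h1.seq (Run.case_of none none rfl rfl (Run.seq (Run.push _ _ _)
      (run_move (by decide) (nameWord v) (litsWord ls) hF (fun _ => inName_of_mem_nameWord)
        (inName_head_litsWord ls))))) ?_ ?_
    · simp [Mem.get, Mem.set, hF, hX, hY, hS, hW, hT, hB, substLit, hvx, litWord]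
    · omega

/-- The sign change `s == t` is never stored: it is read off by comparing the tops of `S` and `W`,
where the signs of the acting clause already lie. -/
theorem run_substitute {m : Mem} {x y : Var} {s t : Bool} {ls : List Lit} {w : ℕ}
    (hF : m.F = litsWord ls) (hX : m.X = nameWord x) (hY : m.Y = nameWord y)
    (hS : m.S = [.sign s]) (hW : m.W = [.sign t]) (hT : m.T = []) (hB : m.B = []) (hG : m.G = [])
    (hls : Narrow w ls) (hy : (nameWord y).length ≤ w) :
    Run .substitute m (ls.length * (25 * w + 30) + 2)
      { m with F := litsWord (ls.map (substLit x y (s == t))) } := by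
  have key : ∀ (ls : List Lit) (m : Mem), m.F = litsWord ls → m.X = nameWord x →
      m.Y = nameWord y → m.S = [.sign s] → m.W = [.sign t] → m.T = [] → m.B = [] → Narrow w ls →
      Run (.loop .F .F (fun a _ => anySym a) (.case .F .F fun a _ =>
        match a with
        | some (.sign b) => .pop .F ;; .replaceLit b
        | _ => .nop)) m (ls.length * (21 * w + 24) + 1)
        { m with F := [], G := (litsWord (ls.map (substLit x y (s == t)))).reverse ++ m.G } := by
    intro ls
    induction ls with
    | nil =>
      intro m hF hX hY hS hW hT hB hls
      refine Run.to (Run.loop_done (by simp [Mem.get, hF, anySym])) ?_ (by simp)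
      obtain ⟨⟩ := m
      cases hF
      rfl
    | cons l ls ih =>
      intro m hF hX hY hS hW hT hB hls
      rw [litsWord_cons] at hF
      have h2 := ih { m with F := litsWord ls, G :=
        (litWord (substLit x y (s == t) (l.1, l.2))).reverse ++ m.G } rfl hX hY hS hW hT hB
        fun l hl => hls l (List.mem_cons_of_mem _ hl)
      refine Run.to (Run.loop_step (by simp [Mem.get, hF, anySym])
        (Run.case_of (some (.sign l.2)) (some (.sign l.2)) (by simp [Mem.get, hF])
          (by simp [Mem.get, hF]) (Run.seq (Run.pop _ _) (run_replaceLit (v := l.1) (ls := ls)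
            (by simp [Mem.get, Mem.set, hF]) hX hY hS hW hT hB (hls l List.mem_cons_self) hy)))
          h2) ?_ ?_
      · simp [litWord]
      · rw [List.length_cons, Nat.succ_mul (List.length _)]
        omega
  have h1 := key ls m hF hX hY hS hW hT hB hls
  refine Run.to (h1.seq (run_move_all (by decide) rfl)) ?_ ?_
  · simp [Mem.get, Mem.set, hG]
  · have h2 := length_litsWord_le (hls.substLit (x := x) (s == t) hy)
    simp only [Mem.get, hG, List.append_nil, List.length_reverse]
    rw [List.length_map] at h2
    have h3 : ls.length * (21 * w + 24) + 4 * (ls.length * (w + 1)) ≤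
        ls.length * (25 * w + 30) := by
      rw [← mul_assoc, mul_comm 4, mul_assoc, ← mul_add]
      exact Nat.mul_le_mul_left _ (by omega)
    omega

/-! ### Reading a clause -/

namespace Prog

/-- Take a clause from `F`: the names go to `X` and `Y`, the signs to `S` and `W`, and `B` is marked
if the names are the same. -/
def load : Prog :=
  .moveOne .F .S ;; .move inName .F .T ;; .move anySym .T .X ;; .moveOne .F .W ;; .compareName ;;
  .move inName .F .T ;; .move anySym .T .Y

/-- Put a clause that has been read on `k`. -/
def unload (k : Reg) : Prog :=
  .moveOne .S k ;; .move anySym .X k ;; .moveOne .W k ;; .move anySym .Y k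

/-- Move the special clauses to the front. -/
def sort : Prog :=
  .loop .F .F (fun a _ => anySym a) (load ;; .case .B .B fun a _ =>
    if a = none then .case .X .Y (fun a b =>
      if a = some .clause ∨ b = some .clause then unload .U else unload .G)
    else .pop .B ;; unload .U) ;;
  .move anySym .G .F ;; .move anySym .U .F

end Prog

/-- The names are compared while the second is still on `F` and the first already on `X`, the
position that `compareName` expects. -/
theorem run_load {m : Mem} {c : Pair} {ls : List Lit} {w : ℕ}
    (hF : m.F = litsWord (c.1 :: c.2 :: ls)) (hX : m.X = []) (hY : m.Y = []) (hS : m.S = [])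
    (hW : m.W = []) (hT : m.T = []) (hB : m.B = []) (h1 : (nameWord c.1.1).length ≤ w)
    (h2 : (nameWord c.2.1).length ≤ w) :
    Run .load m (26 * w + 15) 
      { m with F := litsWord ls, X := nameWord c.1.1, S := [.sign c.1.2], Y := nameWord c.2.1,
               W := [.sign c.2.2], B := if c.1.1 = c.2.1 then [.clause] else [] } := by
  rw [litsWord_cons, litsWord_cons] at hF
  refine Run.to (Run.seq (run_moveOne (by decide) hF)
    (Run.seq (run_move (by decide) _ _ rfl (fun _ => inName_of_mem_nameWord) rfl)
    (Run.seq (run_move_all (by decide) rfl)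
    (Run.seq (run_moveOne (by decide) rfl)
    (Run.seq (run_compareName (nameWord c.2.1) (nameWord c.1.1) (litsWord ls) rfl
      (by simp [Mem.get, Mem.set, hX, hT]) (by simp [Mem.get, Mem.set])
      (fun _ => inName_of_mem_nameWord) (inName_head_litsWord ls))
    (Run.seq (run_move (by decide) _ _ rfl (fun _ => inName_of_mem_nameWord)
      (inName_head_litsWord ls))
    (run_move_all (by decide) rfl))))))) ?_ ?_
  · simp [Mem.get, Mem.set, hX, hY, hS, hW, hT, hB, nameWord_eq_iff, eq_comm]
  · simp [Mem.get, Mem.set, hT]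
    omega

theorem run_unload_U {m : Mem} {c : Pair} {w : ℕ} (hX : m.X = nameWord c.1.1)
    (hS : m.S = [.sign c.1.2]) (hY : m.Y = nameWord c.2.1) (hW : m.W = [.sign c.2.2])
    (h1 : (nameWord c.1.1).length ≤ w) (h2 : (nameWord c.2.1).length ≤ w) :
    Run (.unload .U) m (8 * w + 8)
      { m with X := [], S := [], Y := [], W := [], U := (litsWord [c.1, c.2]).reverse ++ m.U } := by
  refine Run.to (Run.seq (run_moveOne (by decide) hS) (Run.seq (run_move_all (by decide) hX)
    (Run.seq (run_moveOne (by decide) hW) (run_move_all (by decide) hY)))) ?_ ?_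
  · simp [Mem.get, Mem.set]
  · omega

theorem run_unload_G {m : Mem} {c : Pair} {w : ℕ} (hX : m.X = nameWord c.1.1)
    (hS : m.S = [.sign c.1.2]) (hY : m.Y = nameWord c.2.1) (hW : m.W = [.sign c.2.2])
    (h1 : (nameWord c.1.1).length ≤ w) (h2 : (nameWord c.2.1).length ≤ w) :
    Run (.unload .G) m (8 * w + 8)
      { m with X := [], S := [], Y := [], W := [], G := (litsWord [c.1, c.2]).reverse ++ m.G } := by
  refine Run.to (Run.seq (run_moveOne (by decide) hS) (Run.seq (run_move_all (by decide) hX)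
    (Run.seq (run_moveOne (by decide) hW) (run_move_all (by decide) hY)))) ?_ ?_
  · simp [Mem.get, Mem.set]
  · omega

@[simp] theorem literals_nil : literals [] = [] := rfl

@[simp] theorem literals_cons (c : Pair) (φ : List Pair) :
    literals (c :: φ) = c.1 :: c.2 :: literals φ := rfl

@[simp] theorem literals_append (φ ψ : List Pair) :
    literals (φ ++ ψ) = literals φ ++ literals ψ := List.flatMap_append

theorem literals_map_substPair (x y : Var) (r : Bool) (φ : List Pair) :
    literals (φ.map (substPair x y r)) = (literals φ).map (substLit x y r) := by
  induction φ with
  | nil => rfl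
  | cons c φ ih => simp [substPair, ih]

theorem run_sort {m : Mem} {φ : List Pair} {w : ℕ} (hF : m.F = litsWord (literals φ))
    (hG : m.G = []) (hU : m.U = []) (hX : m.X = []) (hY : m.Y = []) (hS : m.S = [])
    (hW : m.W = []) (hT : m.T = []) (hB : m.B = []) (hφ : Narrow w (literals φ)) :
    Run .sort m (φ.length * (42 * w + 37) + 3) { m with F := litsWord (literals (order φ)) } := by
  have key : ∀ (φ : List Pair) (m : Mem), m.F = litsWord (literals φ) → m.X = [] → m.Y = [] →
      m.S = [] → m.W = [] → m.T = [] → m.B = [] → Narrow w (literals φ) →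
      Run (.loop .F .F (fun a _ => anySym a) (.load ;; .case .B .B fun a _ =>
        if a = none then .case .X .Y (fun a b =>
          if a = some .clause ∨ b = some .clause then .unload .U else .unload .G)
        else .pop .B ;; .unload .U)) m (φ.length * (34 * w + 27) + 1)
        { m with F := [], U := (litsWord (literals (φ.filter special))).reverse ++ m.U,
                 G := (litsWord (literals (φ.filter fun c => !special c))).reverse ++ m.G } := by
    intro φ
    induction φ with
    | nil =>
      intro m hF hX hY hS hW hT hB hφ
      refine Run.to (Run.loop_done (by simp [Mem.get, hF, anySym])) ?_ (by simp)
      obtain ⟨⟩ := m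
      cases hF
      rfl
    | cons c φ ih =>
      intro m hF hX hY hS hW hT hB hφ
      rw [literals_cons] at hF
      have hc1 := hφ c.1 (by simp)
      have hc2 := hφ c.2 (by simp)
      have h1 := run_load hF hX hY hS hW hT hB hc1 hc2
      have hstep : Run (.load ;; .case .B .B fun a _ =>
          if a = none then .case .X .Y (fun a b =>
            if a = some .clause ∨ b = some .clause then .unload .U else .unload .G)
          else .pop .B ;; .unload .U) m (34 * w + 26)
          { m with F := litsWord (literals φ),
                   U := if special c then (litsWord [c.1, c.2]).reverse ++ m.U else m.U,
                   G := if special c then m.G else (litsWord [c.1, c.2]).reverse ++ m.G } := by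
        by_cases hxy : c.1.1 = c.2.1
        · rw [if_pos hxy] at h1
          refine Run.to (h1.seq (Run.case_of (some .clause) (some .clause) rfl rfl
            (Run.seq (Run.pop _ _) (run_unload_U (c := c) rfl rfl rfl rfl hc1 hc2)))) ?_ (by omega)
          have : special c = true := by simp [special, hxy]
          simp [Mem.get, Mem.set, this, hX, hY, hS, hW, hB]
        · rw [if_neg hxy] at h1
          by_cases hn : c.1.1 = none ∨ c.2.1 = none
          · refine Run.to (h1.seq (Run.case_of none none rfl rfl (Run.case_of (nameWord c.1.1).head?
              (nameWord c.2.1).head? rfl rfl ?_ (n := 8 * w + 8)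
              (m' := { m with F := litsWord (literals φ), B := [], X := [], S := [], Y := [],
                              W := [], U := (litsWord [c.1, c.2]).reverse ++ m.U }))))
              ?_ (by omega)
            · simp only [head_nameWord_eq_clause_iff, if_pos hn]
              exact run_unload_U (c := c) rfl rfl rfl rfl hc1 hc2
            · have : special c = true := by simp [special, hn]
              simp [this, hX, hY, hS, hW, hB]
          · refine Run.to (h1.seq (Run.case_of none none rfl rfl (Run.case_of (nameWord c.1.1).head?
              (nameWord c.2.1).head? rfl rfl ?_ (n := 8 * w + 8)
              (m' := { m with F := litsWord (literals φ), B := [], X := [], S := [], Y := [],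
                              W := [], G := (litsWord [c.1, c.2]).reverse ++ m.G }))))
              ?_ (by omega)
            · simp only [head_nameWord_eq_clause_iff, if_neg hn]
              exact run_unload_G (c := c) rfl rfl rfl rfl hc1 hc2
            · have : special c = false := by
                push Not at hn
                simp [special, hxy, hn]
              simp [this, hX, hY, hS, hW, hB]
      have h2 := ih { m with F := litsWord (literals φ),
                             U := if special c then (litsWord [c.1, c.2]).reverse ++ m.U else m.U,
                             G := if special c then m.G else (litsWord [c.1, c.2]).reverse ++ m.G }
          rfl hX hY hS hW hT hB fun l hl => hφ l (by simp [hl])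
      refine Run.to (Run.loop_step (by simp [Mem.get, hF, anySym]) hstep h2) ?_ ?_
      · cases hs : special c <;> simp [hs]
      · rw [List.length_cons, Nat.succ_mul (List.length _)]
        omega
  have h1 := key φ m hF hX hY hS hW hT hB hφ
  -- `G` is emptied before `U`, so the special clauses end on top; each group is reversed twice and
  -- keeps its order.
  refine Run.to (h1.seq (Run.seq (run_move_all (by decide) rfl) (run_move_all (by decide) rfl))) ?_ ?_
  · simp [Mem.get, Mem.set, hG, hU, order]
  · have h2 := length_litsWord_le hφ
    have h3 : (litsWord (literals φ)).length = (litsWord (literals (φ.filter special))).length +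
        (litsWord (literals (φ.filter fun c => !special c))).length := by
      have := ((order_perm φ).flatMap_right fun c => litsWord [c.1, c.2]).length_eq
      have e : ∀ ψ : List Pair, ψ.flatMap (fun c => litsWord [c.1, c.2]) =
          litsWord (literals ψ) := by
        intro ψ
        simp [litsWord, literals, List.flatMap_assoc]
      rw [e, e, order, literals_append, litsWord_append, List.length_append] at this
      exact this.symm
    rw [literals_length] at h2
    simp only [Mem.get, Mem.set, hG, hU, List.append_nil, List.length_reverse]
    have h4 : φ.length * (34 * w + 27) + 4 * (2 * φ.length * (w + 1)) ≤
        φ.length * (42 * w + 37) := by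
      rw [show 4 * (2 * φ.length * (w + 1)) = φ.length * (8 * w + 8) by ring, ← mul_add]
      exact Nat.mul_le_mul_left _ (by omega)
    omega

/-! ### The main loop -/

namespace Prog

/-- Exchange the two literals of a clause that has been read. -/
def swap : Prog :=
  .move anySym .X .T ;; .move anySym .T .G ;; .move anySym .Y .T ;; .move anySym .T .X ;;
  .move anySym .G .T ;; .move anySym .T .Y ;; .moveOne .S .T ;; .moveOne .W .S ;; .moveOne .T .W

/-- Put a constant into the second place. -/
def normalizeTop : Prog := .case .X .X fun a _ => if a = some .clause then swap else .nop

/-- Let the clause that has been read act on the others. -/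
def act : Prog :=
  .case .Y .W fun a t =>
    if a = some .clause then
      if t = some (.sign false) then .nop
      else .case .X .S fun a s =>
        if a = some .clause then (if s = some (.sign true) then .push .R .clause else .nop)
        else substitute ;; .pop .N
    else .case .S .W fun s t => .case .B .B fun b _ =>
      if b = none then substitute
      else if s = t then
        .pop .B ;; .clear anySym .Y ;; .push .Y .clause ;; .pop .W ;; .push .W (.sign true) ;;
        substitute ;; .pop .N
      else .nop

/-- Forget the clause that has been read. -/
def forget : Prog :=
  .clear anySym .X ;; .clear anySym .Y ;; .clear anySym .S ;; .clear anySym .W ;; .clear anySym .B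

/-- Treat one clause. -/
def round : Prog := sort ;; load ;; normalizeTop ;; act ;; forget

/-- Treat all clauses. -/
def solveLoop : Prog := .loop .F .F (fun a _ => anySym a) round

end Prog

/-- The other clauses, the loss and the number of contradictions after a clause has acted. -/
def outcome (c : Pair) (φ : List Pair) : List Pair × ℕ × ℕ :=
  match clauseAction c with
  | .drop => (φ, 0, 0)
  | .reject => (φ, 0, 1)
  | .subst x y r j => (φ.map (substPair x y r), j, 0)

theorem solve_succ {k : ℕ} {φ ψ : List Pair} {c : Pair} (h : order φ = c :: ψ) :
    solve (k + 1) φ = ((solve k (outcome (normalize c) ψ).1).1 + (outcome (normalize c) ψ).2.1,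
      (solve k (outcome (normalize c) ψ).1).2 + (outcome (normalize c) ψ).2.2) := by
  simp only [solve, h, outcome]
  cases clauseAction (normalize c) <;> rfl

theorem outcome_length (c : Pair) (φ : List Pair) : (outcome c φ).1.length = φ.length := by
  unfold outcome
  split <;> simp

theorem narrow_outcome {w : ℕ} (hw : 1 ≤ w) {c : Pair} {φ : List Pair}
    (hφ : Narrow w (literals φ)) (hc : (nameWord c.2.1).length ≤ w) :
    Narrow w (literals (outcome c φ).1) := by
  unfold outcome clauseAction
  split_ifs <;> first
    | exact hφ
    | (simp only [literals_map_substPair]; exact hφ.substLit _ hw)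
    | (simp only [literals_map_substPair]; exact hφ.substLit _ hc)

theorem run_normalizeTop {m : Mem} {c : Pair} {w : ℕ} (hX : m.X = nameWord c.1.1)
    (hS : m.S = [.sign c.1.2]) (hY : m.Y = nameWord c.2.1) (hW : m.W = [.sign c.2.2])
    (hT : m.T = []) (hG : m.G = [])
    (h1 : (nameWord c.1.1).length ≤ w) (h2 : (nameWord c.2.1).length ≤ w) :
    Run .normalizeTop m (24 * w + 16)
      { m with X := nameWord (normalize c).1.1, S := [.sign (normalize c).1.2],
               Y := nameWord (normalize c).2.1, W := [.sign (normalize c).2.2] } := by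
  have hswap : Run .swap m (24 * w + 15)
      { m with X := nameWord c.2.1, S := [.sign c.2.2], Y := nameWord c.1.1,
               W := [.sign c.1.2] } := by
    have e1 : Run (.move anySym .X .T) m (4 * w + 1)
        { m with X := [], T := (nameWord c.1.1).reverse } :=
      Run.to (run_move_all (by decide) hX) (by simp [Mem.get, Mem.set, hT]) (by omega)
    have e2 : Run (.move anySym .T .G) { m with X := [], T := (nameWord c.1.1).reverse }
        (4 * w + 1) { m with X := [], G := nameWord c.1.1 } :=
      Run.to (run_move_all (by decide) rfl) (by simp [Mem.get, Mem.set, hG, hT])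
        (by simp [Mem.get]; omega)
    have e3 : Run (.move anySym .Y .T) { m with X := [], G := nameWord c.1.1 } (4 * w + 1)
        { m with X := [], G := nameWord c.1.1, Y := [], T := (nameWord c.2.1).reverse } :=
      Run.to (run_move_all (by decide) hY) (by simp [Mem.get, Mem.set, hT]) (by omega)
    have e4 : Run (.move anySym .T .X)
        { m with X := [], G := nameWord c.1.1, Y := [], T := (nameWord c.2.1).reverse }
        (4 * w + 1) { m with X := nameWord c.2.1, G := nameWord c.1.1, Y := [] } :=
      Run.to (run_move_all (by decide) rfl) (by simp [Mem.get, Mem.set, hT])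
        (by simp [Mem.get]; omega)
    have e5 : Run (.move anySym .G .T)
        { m with X := nameWord c.2.1, G := nameWord c.1.1, Y := [] } (4 * w + 1)
        { m with X := nameWord c.2.1, Y := [], T := (nameWord c.1.1).reverse } :=
      Run.to (run_move_all (by decide) rfl) (by simp [Mem.get, Mem.set, hG, hT])
        (by simp [Mem.get]; omega)
    have e6 : Run (.move anySym .T .Y)
        { m with X := nameWord c.2.1, Y := [], T := (nameWord c.1.1).reverse } (4 * w + 1)
        { m with X := nameWord c.2.1, Y := nameWord c.1.1 } :=
      Run.to (run_move_all (by decide) rfl) (by simp [Mem.get, Mem.set, hT])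
        (by simp [Mem.get]; omega)
    have e7 : Run (.moveOne .S .T ;; .moveOne .W .S ;; .moveOne .T .W)
        { m with X := nameWord c.2.1, Y := nameWord c.1.1 } 9
        { m with X := nameWord c.2.1, S := [.sign c.2.2], Y := nameWord c.1.1,
                 W := [.sign c.1.2] } :=
      Run.to (Run.seq (run_moveOne (by decide) hS) (Run.seq (run_moveOne (by decide) hW)
        (run_moveOne (by decide) rfl))) (by simp [Mem.get, Mem.set, hT]) le_rfl
    exact Run.to (e1.seq (e2.seq (e3.seq (e4.seq (e5.seq (e6.seq e7)))))) rfl (by omega)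
  refine Run.to (Run.case_of (nameWord c.1.1).head? (nameWord c.1.1).head? (by rw [← hX]; rfl)
    (by rw [← hX]; rfl) ?_ (n := 24 * w + 15)
    (m' := { m with X := nameWord (normalize c).1.1, S := [.sign (normalize c).1.2],
                    Y := nameWord (normalize c).2.1, W := [.sign (normalize c).2.2] })) rfl
    (by omega)
  simp only [head_nameWord_eq_clause_iff]
  unfold normalize
  split_ifs
  · exact hswap
  · refine (Run.nop m).to ?_ (by omega)
    rw [← hX, ← hY, ← hS, ← hW]

/-- The final `Y`, `W` and `B` are known only up to length, which suffices because they are cleared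
next. A loss pops one symbol from `N`; on an empty stack this does nothing, matching truncated
subtraction. -/
theorem run_act {m : Mem} {c : Pair} {φ : List Pair} {w : ℕ} (hw : 1 ≤ w)
    (hF : m.F = litsWord (literals φ)) (hX : m.X = nameWord c.1.1)
    (hS : m.S = [.sign c.1.2]) (hY : m.Y = nameWord c.2.1) (hW : m.W = [.sign c.2.2])
    (hB : m.B = if c.1.1 = c.2.1 then [.clause] else []) (hT : m.T = []) (hG : m.G = [])
    (hn : c.1.1 = none → c.2.1 = none)
    (h2 : (nameWord c.2.1).length ≤ w) (hφ : Narrow w (literals φ)) :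
    ∃ Y' W' B', Y'.length ≤ w ∧ W'.length ≤ 1 ∧ B'.length ≤ 1 ∧
      Run .act m (φ.length * (50 * w + 60) + 2 * w + 11)
        { m with F := litsWord (literals (outcome c φ).1), N := m.N.drop (outcome c φ).2.1,
                 R := List.replicate (outcome c φ).2.2 .clause ++ m.R, Y := Y', W := W',
                 B := B' } := by
  obtain ⟨⟨x, s⟩, ⟨y, t⟩⟩ := c
  simp only at hX hS hY hW hB hn h2
  have hlen : (literals φ).length * (25 * w + 30) = φ.length * (50 * w + 60) := by
    rw [literals_length]
    ring
  have hBlen : m.B.length ≤ 1 := by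
    rw [hB]
    split_ifs <;> simp
  have ha : (m.get .Y).head? = some .clause ↔ y = none := by
    rw [← head_nameWord_eq_clause_iff, ← hY]
    rfl
  have hb : (m.get .X).head? = some .clause ↔ x = none := by
    rw [← head_nameWord_eq_clause_iff, ← hX]
    rfl
  by_cases hy : y = none
  · subst hy
    cases t with
    | false =>
      refine ⟨m.Y, m.W, m.B, by rwa [hY], by rw [hW]; simp, hBlen, Run.to (Run.case_of
        (some .clause) (some (.sign false)) (ha.2 rfl) (by simp [Mem.get, hW]) (Run.nop m))
        ?_ (by omega)⟩
      simp [outcome, clauseAction, ← hF]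
    | true =>
      by_cases hx : x = none
      · subst hx
        refine ⟨m.Y, m.W, m.B, by rwa [hY], by rw [hW]; simp, hBlen, ?_⟩
        cases s with
        | true =>
          refine Run.to (Run.case_of (some .clause) (some (.sign true)) (ha.2 rfl)
            (by simp [Mem.get, hW]) (Run.case_of (some .clause) (some (.sign true)) (hb.2 rfl)
            (by simp [Mem.get, hS]) (Run.push .R .clause m))) ?_ (by omega)
          simp [outcome, clauseAction, Mem.get, Mem.set, hF]
        | false =>
          refine Run.to (Run.case_of (some .clause) (some (.sign true)) (ha.2 rfl)
            (by simp [Mem.get, hW]) (Run.case_of (some .clause) (some (.sign false)) (hb.2 rfl)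
            (by simp [Mem.get, hS]) (Run.nop m))) ?_ (by omega)
          simp [outcome, clauseAction, ← hF]
      · refine ⟨m.Y, m.W, m.B, by rwa [hY], by rw [hW]; simp, hBlen, ?_⟩
        have h3 := run_substitute (x := x) (y := none) hF hX hY hS hW hT (by rw [hB, if_neg hx])
          hG hφ h2
        refine Run.to (Run.case_of (some .clause) (some (.sign true)) (ha.2 rfl)
          (by simp [Mem.get, hW]) (Run.case_of (m.get .X).head? (m.get .S).head? rfl rfl ?_
          (n := (literals φ).length * (25 * w + 30) + 3)
          (m' := { m with F := litsWord ((literals φ).map (substLit x none (s == true))),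
                          N := m.N.tail }))) ?_ (by omega)
        · rw [if_neg (fun h => hx (hb.1 h))]
          exact h3.seq (Run.pop _ _)
        · simp [outcome, clauseAction, hx, literals_map_substPair]
  · have hx : x ≠ none := fun h => hy (hn h)
    by_cases hxy : x = y
    · subst hxy
      rw [if_pos rfl] at hB
      by_cases hst : s = t
      · subst hst
        refine ⟨[.clause], [.sign true], [], by simpa using hw, by simp, by simp, ?_⟩
        -- A repeated literal is rewritten as that literal or the constant `false`. With `true` on
        -- `W` the sign change is `s == true`, that is `s`.
        have h3 := run_substitute (m := { m with B := [], Y := [.clause], W := [.sign true] })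
          (x := x) (y := none) (t := true) hF hX rfl hS rfl hT rfl hG hφ hw
        refine Run.to (Run.case_of (m.get .Y).head? (m.get .W).head? rfl rfl ?_
          (n := (literals φ).length * (25 * w + 30) + 2 * w + 10)
          (m' := { m with F := litsWord ((literals φ).map (substLit x none (s == true))),
                          N := m.N.tail, B := [], Y := [.clause], W := [.sign true] }))
          ?_ (by omega)
        · rw [if_neg (fun h => hy (ha.1 h))]
          refine Run.to (Run.case_of (some (.sign s)) (some (.sign s)) (by simp [Mem.get, hS])
            (by simp [Mem.get, hW]) (Run.case_of (some .clause) (some .clause)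
            (by simp [Mem.get, hB]) (by simp [Mem.get, hB]) ?_
            (n := (literals φ).length * (25 * w + 30) + 2 * w + 8)
            (m' := { m with F := litsWord ((literals φ).map (substLit x none (s == true))),
                            N := m.N.tail, B := [], Y := [.clause], W := [.sign true] })))
            rfl (by omega)
          rw [if_neg (by simp), if_pos rfl]
          refine Run.to (Run.seq (Run.pop .B m) (Run.seq (run_clear_all hY)
            (Run.seq (Run.push .Y .clause _) (Run.seq (Run.pop .W _)
            (Run.seq (Run.push .W (.sign true) _) (Run.seq (h3.to' ?_) (Run.pop .N _)))))))
            rfl (by omega)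
          simp [Mem.get, Mem.set, hB, hW]
        · simp [outcome, clauseAction, hx, literals_map_substPair]
      · refine ⟨m.Y, m.W, m.B, by rwa [hY], by rw [hW]; simp, hBlen, ?_⟩
        refine Run.to (Run.case_of (m.get .Y).head? (m.get .W).head? rfl rfl ?_
          (n := 3) (m' := m)) ?_ (by omega)
        · rw [if_neg (fun h => hy (ha.1 h))]
          refine Run.case_of (some (.sign s)) (some (.sign t)) (by simp [Mem.get, hS])
            (by simp [Mem.get, hW]) (Run.case_of (some .clause) (some .clause)
            (by simp [Mem.get, hB]) (by simp [Mem.get, hB]) ?_)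
          rw [if_neg (by simp), if_neg (by simpa using hst)]
          exact Run.nop m
        · simp [outcome, clauseAction, hx, hst, ← hF]
    · refine ⟨m.Y, m.W, m.B, by rwa [hY], by rw [hW]; simp, hBlen, ?_⟩
      rw [if_neg hxy] at hB
      have h3 := run_substitute hF hX hY hS hW hT hB hG hφ h2
      refine Run.to (Run.case_of (m.get .Y).head? (m.get .W).head? rfl rfl ?_
          (n := (literals φ).length * (25 * w + 30) + 4)
          (m' := { m with F := litsWord ((literals φ).map (substLit x y (s == t))) }))
          ?_ (by omega)
      · rw [if_neg (fun h => hy (ha.1 h))]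
        exact Run.case_of (some (.sign s)) (some (.sign t)) (by simp [Mem.get, hS])
          (by simp [Mem.get, hW]) (Run.case_of none none
          (by simp [Mem.get, hB]) (by simp [Mem.get, hB]) h3)
      · simp [outcome, clauseAction, hy, hxy, literals_map_substPair]

theorem run_forget {m : Mem} {w : ℕ} (hX : m.X.length ≤ w) (hY : m.Y.length ≤ w)
    (hS : m.S.length ≤ 1) (hW : m.W.length ≤ 1) (hB : m.B.length ≤ 1) :
    Run .forget m (4 * w + 11) { m with X := [], Y := [], S := [], W := [], B := [] } := by
  refine Run.to (Run.seq (run_clear_all rfl) (Run.seq (run_clear_all rfl)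
    (Run.seq (run_clear_all rfl) (Run.seq (run_clear_all rfl) (run_clear_all rfl))))) rfl ?_
  simp only [Mem.get, Mem.set]
  omega

theorem run_round {m : Mem} {φ ψ : List Pair} {c : Pair} {w K : ℕ} (hw : 1 ≤ w)
    (hF : m.F = litsWord (literals φ)) (hG : m.G = []) (hU : m.U = []) (hX : m.X = [])
    (hY : m.Y = []) (hS : m.S = []) (hW : m.W = []) (hT : m.T = []) (hB : m.B = [])
    (hφ : Narrow w (literals φ)) (hord : order φ = c :: ψ) (hK : φ.length ≤ K) :
    Run .round m (K * (92 * w + 97) + 56 * w + 56)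
      { m with F := litsWord (literals (outcome (normalize c) ψ).1),
               N := m.N.drop (outcome (normalize c) ψ).2.1,
               R := List.replicate (outcome (normalize c) ψ).2.2 .clause ++ m.R } ∧
      Narrow w (literals (outcome (normalize c) ψ).1) := by
  have hnar : Narrow w (literals (c :: ψ)) := by
    rw [← hord]
    intro l hl
    exact hφ l (((order_perm φ).flatMap_right _).mem_iff.1 hl)
  rw [literals_cons] at hnar
  have hc1 := hnar c.1 (by simp)
  have hc2 := hnar c.2 (by simp)
  have hψ : Narrow w (literals ψ) := fun l hl => hnar l (by simp [hl])
  have hlen : ψ.length ≤ K := by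
    have := order_length φ
    rw [hord, List.length_cons] at this
    omega
  have hn1 : (nameWord (normalize c).1.1).length ≤ w := by
    unfold normalize
    split_ifs
    exacts [hc2, hc1]
  have hn2 : (nameWord (normalize c).2.1).length ≤ w := by
    unfold normalize
    split_ifs
    exacts [hc1, hc2]
  refine ⟨?_, narrow_outcome hw hψ hn2⟩
  have h1 := run_sort hF hG hU hX hY hS hW hT hB hφ
  rw [hord, literals_cons] at h1
  have h2 := run_load (m := { m with F := litsWord (c.1 :: c.2 :: literals ψ) }) rfl hX hY hS hW hT
    hB hc1 hc2
  have h3 := run_normalizeTop (c := c)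
    (m := { m with F := litsWord (literals ψ), X := nameWord c.1.1, S := [.sign c.1.2],
                   Y := nameWord c.2.1, W := [.sign c.2.2],
                   B := if c.1.1 = c.2.1 then [.clause] else [] }) rfl rfl rfl rfl hT hG hc1 hc2
  obtain ⟨Y', W', B', hY', hW', hB', h4⟩ := run_act (c := normalize c) (φ := ψ) (w := w)
    (m := { m with F := litsWord (literals ψ), X := nameWord (normalize c).1.1,
                   S := [.sign (normalize c).1.2], Y := nameWord (normalize c).2.1,
                   W := [.sign (normalize c).2.2],
                   B := if c.1.1 = c.2.1 then [.clause] else [] }) hw rfl rfl rfl rfl rfl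
    -- The mark on `B` was set before the possible exchange of literals; equality of the two names
    -- is symmetric, so it remains correct.
    (by
      unfold normalize
      by_cases h : c.1.1 = none
      · simp [h, eq_comm]
      · simp [h]) hT hG
    (by
      unfold normalize
      split_ifs with h
      · exact fun _ => h
      · exact fun h' => absurd h' h) hn2 hψ
  refine Run.to (Run.seq h1 (Run.seq h2 (Run.seq h3 (Run.seq h4 (run_forget (w := w) hn1 hY'
    (by simp) hW' hB'))))) ?_ ?_
  · simp [hX, hY, hS, hW, hB]
  · have e1 := Nat.mul_le_mul_right (42 * w + 37) hK
    have e2 := Nat.mul_le_mul_right (50 * w + 60) hlen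
    have e3 : K * (42 * w + 37) + K * (50 * w + 60) = K * (92 * w + 97) := by ring
    omega

/-- The fixed `K` bounds the number of clauses in every round, so the cost is a constant multiple of
the number `k` of remaining rounds. -/
theorem run_solveLoop {w K : ℕ} (hw : 1 ≤ w) : ∀ (k : ℕ) (φ : List Pair) (m : Mem),
    φ.length = k → k ≤ K → m.F = litsWord (literals φ) → m.G = [] → m.U = [] → m.X = [] →
    m.Y = [] → m.S = [] → m.W = [] → m.T = [] → m.B = [] → Narrow w (literals φ) →
    Run .solveLoop m (k * (K * (92 * w + 97) + 56 * w + 57) + 1)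
      { m with F := [], N := m.N.drop (solve k φ).1,
               R := List.replicate (solve k φ).2 .clause ++ m.R } := by
  intro k
  induction k with
  | zero =>
    intro φ m hlen hK hF hG hU hX hY hS hW hT hB hφ
    obtain rfl := List.length_eq_zero_iff.1 hlen
    refine Run.to (Run.loop_done (by simp [Mem.get, hF, anySym])) ?_ (by omega)
    obtain ⟨⟩ := m
    cases hF
    rfl
  | succ k ih =>
    intro φ m hlen hK hF hG hU hX hY hS hW hT hB hφ
    obtain ⟨c, ψ, hord⟩ : ∃ c ψ, order φ = c :: ψ := by
      cases h : order φ with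
      | nil =>
        have := order_length φ
        rw [h, hlen] at this
        simp at this
      | cons c ψ => exact ⟨c, ψ, rfl⟩
    obtain ⟨h1, h2⟩ := run_round hw hF hG hU hX hY hS hW hT hB hφ hord (hlen.le.trans hK)
    have hlen' : (outcome (normalize c) ψ).1.length = k := by
      have := order_length φ
      rw [hord, hlen, List.length_cons] at this
      rw [outcome_length]
      omega
    have h3 := ih (outcome (normalize c) ψ).1
      { m with F := litsWord (literals (outcome (normalize c) ψ).1),
               N := m.N.drop (outcome (normalize c) ψ).2.1,
               R := List.replicate (outcome (normalize c) ψ).2.2 .clause ++ m.R }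
      hlen' (by omega) rfl hG hU hX hY hS hW hT hB h2
    refine Run.to (Run.loop_step ?_ h1 h3) ?_ ?_
    · obtain ⟨d, φ, rfl⟩ := List.exists_cons_of_length_eq_add_one hlen
      simp [Mem.get, hF, anySym]
    · rw [solve_succ hord]
      simp only [List.drop_drop, ← List.append_assoc, List.replicate_append_replicate,
        Nat.add_comm (outcome (normalize c) ψ).2.1]
    · rw [Nat.succ_mul k]
      omega

/-! ### Counting the variables -/

namespace Prog

/-- Count the different variables of the literals on `F`. -/
def countVars : Prog :=
  .loop .F .F (fun a _ => anySym a) (.moveOne .F .S ;; .case .F .F fun a _ =>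
    if a = some .clause then .pop .F ;; .pop .S
    else .move inName .F .T ;; .move anySym .T .X ;; .push .Y .clause ;; .push .W (.sign true) ;;
      substitute ;; .clear anySym .X ;; .pop .Y ;; .pop .S ;; .pop .W ;; .push .N .clause)

/-- Read a literal of a formula; a missing literal is the constant `false`. -/
def parseLit : Prog :=
  .case .F .F fun a _ =>
    if a = some (.sign true) ∨ a = some (.sign false) then .moveOne .F .G ;; .move isBit .F .G
    else .push .G (.sign true) ;; .push .G .clause

/-- Read an instance: the number goes to `D` and the literals to `F` and `C`. -/
def parse : Prog :=
  .move isBit .F .T ;; .move anySym .T .D ;;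
  .loop .F .F (fun a _ => anySym a) (.pop .F ;; parseLit ;; parseLit) ;; .fork .G .F .C

/-- Halve the number of symbols on `N`. -/
def halve : Prog :=
  .loop .N .N (fun a _ => anySym a) (.pop .N ;; .case .N .N fun a _ =>
    if a = none then .nop else .pop .N ;; .push .T .clause) ;;
  .move anySym .T .N

/-- Subtract the number on `D` from the number of symbols on `N`, and report failures on `R`. -/
def compareBits : Prog :=
  .loop .D .D (fun a _ => anySym a) (.case .D .D fun a _ => .pop .D ;;
    (if a = some (.bit true) then
      .case .N .N fun a _ => if a = none then .push .R .clause else .pop .N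
    else .nop) ;; halve)

/-- Clear all stacks and answer whether `R` was empty. -/
def answer : Prog :=
  .clear anySym .N ;; .case .R .R fun a _ =>
    if a = none then .push .R (.bit true) else .clear anySym .R ;; .push .R (.bit false)

/-- The decision procedure. -/
def decision : Prog :=
  parse ;; countVars ;; .move anySym .C .T ;; .move anySym .T .F ;; solveLoop ;; compareBits ;;
  answer

end Prog

theorem head_nameWord_append_eq_clause_iff (v : Var) (ls : List Lit) :
    (nameWord v ++ litsWord ls).head? = some .clause ↔ v = none := by
  rw [← head_nameWord_eq_clause_iff]
  cases nameWord v <;> cases ls <;> simp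

theorem run_countVars {w K : ℕ} (hw : 1 ≤ w) : ∀ (k : ℕ) (ls : List Lit) (m : Mem),
    ls.length = k → k ≤ K → m.F = litsWord ls → m.G = [] → m.X = [] → m.Y = [] → m.S = [] →
    m.W = [] → m.T = [] → m.B = [] → Narrow w ls →
    Run .countVars m (k * (K * (25 * w + 30) + 10 * w + 20) + 1)
      { m with F := [], N := List.replicate (distinctVars k ls) .clause ++ m.N } := by
  intro k
  induction k with
  | zero =>
    intro ls m hlen hK hF hG hX hY hS hW hT hB hls
    obtain rfl := List.length_eq_zero_iff.1 hlen
    refine Run.to (Run.loop_done (by simp [Mem.get, hF, anySym])) ?_ (by omega)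
    obtain ⟨⟩ := m
    cases hF
    rfl
  | succ k ih =>
    intro ls m hlen hK hF hG hX hY hS hW hT hB hls
    obtain ⟨l, ls, rfl⟩ := List.exists_cons_of_length_eq_add_one hlen
    simp only [List.length_cons, Nat.add_right_cancel_iff] at hlen
    have hl := hls l List.mem_cons_self
    have hls' : Narrow w ls := fun l hl => hls l (List.mem_cons_of_mem _ hl)
    rw [litsWord_cons] at hF
    have hhead : (m.get .F).head? = some (.sign l.2) := by simp [Mem.get, hF]
    have h1 : Run (.moveOne .F .S) m 3
        { m with F := nameWord l.1 ++ litsWord ls, S := [.sign l.2] } :=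
      Run.to (run_moveOne (by decide) hF) (by simp [Mem.get, Mem.set, hS]) le_rfl
    have hc := head_nameWord_append_eq_clause_iff l.1 ls
    by_cases hn : l.1 = none
    · have h2 := ih ls { m with F := litsWord ls } hlen (by omega) rfl hG hX hY hS hW hT hB hls'
      refine Run.to (Run.loop_step (by rw [hhead]; rfl) (Run.seq h1 (Run.case_of (some .clause)
        (some .clause) (hc.2 hn) (hc.2 hn) (Run.seq (Run.pop _ _) (Run.pop _ _))))
        (h2.to' ?_)) ?_ ?_
      · simp [Mem.get, Mem.set, hn, hS, nameWord]
      · simp [distinctVars, hn]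
      · rw [Nat.succ_mul k]
        omega
    · have h2 : Run (.move inName .F .T)
          { m with F := nameWord l.1 ++ litsWord ls, S := [.sign l.2] } (4 * w + 1)
          { m with F := litsWord ls, S := [.sign l.2], T := (nameWord l.1).reverse } :=
        Run.to (run_move (by decide) _ _ rfl (fun _ => inName_of_mem_nameWord)
          (inName_head_litsWord ls)) (by simp [Mem.get, Mem.set, hT]) (by omega)
      have h3 : Run (.move anySym .T .X)
          { m with F := litsWord ls, S := [.sign l.2], T := (nameWord l.1).reverse } (4 * w + 1)
          { m with F := litsWord ls, S := [.sign l.2], X := nameWord l.1 } :=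
        Run.to (run_move_all (by decide) rfl) (by simp [Mem.get, Mem.set, hT, hX])
          (by simp [Mem.get]; omega)
      have h4 : Run (.push .Y .clause)
          { m with F := litsWord ls, S := [.sign l.2], X := nameWord l.1 } 1
          { m with F := litsWord ls, S := [.sign l.2], X := nameWord l.1, Y := [.clause] } :=
        Run.to (Run.push _ _ _) (by simp [Mem.get, Mem.set, hY]) le_rfl
      have h5 : Run (.push .W (.sign true))
          { m with F := litsWord ls, S := [.sign l.2], X := nameWord l.1, Y := [.clause] } 1
          { m with F := litsWord ls, S := [.sign l.2], X := nameWord l.1, Y := [.clause],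
                   W := [.sign true] } :=
        Run.to (Run.push _ _ _) (by simp [Mem.get, Mem.set, hW]) le_rfl
      -- For counting, the signs are irrelevant. The choice `t = true` makes the sign change equal
      -- to `l.2`, as in `distinctVars`.
      have h6 := run_substitute (ls := ls) (w := w) (x := l.1) (y := none) (s := l.2) (t := true)
        (m := { m with F := litsWord ls, S := [.sign l.2], X := nameWord l.1, Y := [.clause],
                       W := [.sign true] }) rfl rfl rfl rfl rfl hT hB hG hls' hw
      have h7 : Run (.clear anySym .X ;; .pop .Y ;; .pop .S ;; .pop .W ;; .push .N .clause)
          { m with F := litsWord (ls.map (substLit l.1 none (l.2 == true))), S := [.sign l.2],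
                   X := nameWord l.1, Y := [.clause], W := [.sign true] } (2 * w + 5)
          { m with F := litsWord (ls.map (substLit l.1 none (l.2 == true))),
                   N := .clause :: m.N } :=
        Run.to (Run.seq (run_clear_all rfl) (Run.seq (Run.pop _ _) (Run.seq (Run.pop _ _)
          (Run.seq (Run.pop _ _) (Run.push _ _ _)))))
          (by simp [Mem.get, Mem.set, hX, hY, hS, hW]) (by simp only [Mem.get]; omega)
      have h8 := ih (ls.map (substLit l.1 none (l.2 == true)))
        { m with F := litsWord (ls.map (substLit l.1 none (l.2 == true))), N := .clause :: m.N }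
        (by rwa [List.length_map]) (by omega) rfl hG hX hY hS hW hT hB (hls'.substLit _ hw)
      refine Run.to (Run.loop_step (by rw [hhead]; rfl) (Run.seq h1 (Run.case_of
        (nameWord l.1 ++ litsWord ls).head? (nameWord l.1 ++ litsWord ls).head? rfl rfl ?_
        (n := ls.length * (25 * w + 30) + 10 * w + 11)
        (m' := { m with F := litsWord (ls.map (substLit l.1 none (l.2 == true))),
                        N := .clause :: m.N }))) h8) ?_ ?_
      · rw [if_neg fun h => hn (hc.1 h)]
        exact Run.to (h2.seq (h3.seq (h4.seq (h5.seq (h6.seq h7))))) rfl (by omega)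
      · simp only [distinctVars, if_neg hn, List.replicate_succ', beq_true,
          List.append_assoc, List.singleton_append]
      · have : ls.length * (25 * w + 30) ≤ K * (25 * w + 30) :=
          Nat.mul_le_mul_right _ (by omega)
        rw [Nat.succ_mul k]
        omega

/-! ### Reading the input -/

/-- The first literal of a clause, or the constant `false`. -/
def headLit : Clause → Lit
  | [] => (none, true)
  | l :: _ => liftLit l

theorem toPair_eq (C : Clause) : toPair C = (headLit C, headLit C.tail) := by
  rcases C with _ | ⟨a, _ | ⟨b, C⟩⟩ <;> rfl

theorem run_parseLit {m : Mem} {C : Clause} {r : List Sym} {w : ℕ}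
    (hF : m.F = C.flatMap encodeLiteral ++ r) (hr : r.head? = none ∨ r.head? = some .clause)
    (hC : (nameWord (headLit C).1).length ≤ w) :
    Run .parseLit m (4 * w + 5)
      { m with F := C.tail.flatMap encodeLiteral ++ r, G := (litWord (headLit C)).reverse ++ m.G } := by
  cases C with
  | nil =>
    refine Run.to (Run.case_of r.head? r.head? (by simp [Mem.get, hF]) (by simp [Mem.get, hF]) ?_
      (n := 2) (m' := { m with G := .clause :: .sign true :: m.G })) ?_ (by omega)
    · rw [if_neg (by rcases hr with hr | hr <;> simp [hr])]
      exact Run.seq (Run.push _ _ _) (Run.push _ _ _)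
    · simp [headLit, litWord, nameWord, hF]
  | cons l C =>
    simp only [List.flatMap_cons, encodeLiteral, List.cons_append, List.append_assoc] at hF
    have hb : isBit (C.flatMap encodeLiteral ++ r).head? = false := by
      cases C with
      | nil => rcases hr with hr | hr <;> simp [hr, isBit]
      | cons l' C => rfl
    refine Run.to (Run.case_of (some (.sign l.2)) (some (.sign l.2)) (by simp [Mem.get, hF])
      (by simp [Mem.get, hF]) ?_ (n := 4 * w + 4) (m' := { m with
        F := C.flatMap encodeLiteral ++ r,
        G := (encodeNum l.1).reverse ++ .sign l.2 :: m.G })) ?_ (by omega)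
    · rw [if_pos (by cases l.2 <;> simp)]
      refine Run.to (Run.seq (run_moveOne (by decide) hF) (run_move (by decide) (encodeNum l.1)
        (C.flatMap encodeLiteral ++ r) rfl (fun _ => isBit_of_mem_encodeNum) hb)) rfl ?_
      change (encodeNum l.1).length ≤ w at hC
      omega
    · simp [headLit, litWord, nameWord, liftLit]

theorem run_parse {φ : CNF} {d w : ℕ} (hφ : IsTwoCNF φ) (hd : (encodeNum d).length ≤ w)
    (hw : Narrow w (literals (φ.map toPair))) :
    Run .parse { F := encodeInstance (φ, d) } (φ.length * (18 * w + 22) + 8 * w + 4)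
      { F := litsWord (literals (φ.map toPair)), C := litsWord (literals (φ.map toPair)),
        D := encodeNum d } := by
  have key : ∀ (φ : CNF) (m : Mem), IsTwoCNF φ → Narrow w (literals (φ.map toPair)) →
      m.F = encodeCNF φ →
      Run (.loop .F .F (fun a _ => anySym a) (.pop .F ;; .parseLit ;; .parseLit)) m
        (φ.length * (8 * w + 12) + 1)
        { m with F := [], G := (litsWord (literals (φ.map toPair))).reverse ++ m.G } := by
    intro φ
    induction φ with
    | nil =>
      intro m _ _ hF
      refine Run.to (Run.loop_done (by rw [Mem.get, hF]; rfl)) ?_ (by simp)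
      obtain ⟨⟩ := m
      cases hF
      rfl
    | cons C φ ih =>
      intro m hφ hw hF
      have hF' : m.F = .clause :: (C.flatMap encodeLiteral ++ encodeCNF φ) := by
        rw [hF]
        simp [encodeCNF, encodeClause]
      rw [List.map_cons, literals_cons, toPair_eq] at hw
      have h1 := run_parseLit (w := w) (C := C)
        (m := { m with F := C.flatMap encodeLiteral ++ encodeCNF φ }) rfl (encodeCNF_head φ)
        (hw _ (by simp))
      have h2 := run_parseLit (w := w) (C := C.tail)
        (m := { m with F := C.tail.flatMap encodeLiteral ++ encodeCNF φ,
                       G := (litWord (headLit C)).reverse ++ m.G }) rfl (encodeCNF_head φ)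
        (hw _ (by simp))
      have hlen := hφ C (by simp)
      -- At most two literals per clause: after two readings the input stands at the next clause.
      have htail : C.tail.tail = [] := by
        rcases C with _ | ⟨a, _ | ⟨b, _ | ⟨c, C⟩⟩⟩ <;> simp at hlen ⊢
      rw [htail] at h2
      have h3 := ih
        { m with F := encodeCNF φ,
                 G := (litWord (headLit C.tail)).reverse ++ ((litWord (headLit C)).reverse ++ m.G) }
        (fun D hD => hφ D (by simp [hD])) (fun l hl => hw l (by simp [hl])) rfl
      refine Run.to (Run.loop_step (by rw [Mem.get, hF']; rfl)
        (Run.seq (Run.to (Run.pop .F m) (by rw [Mem.get, hF']; rfl) le_rfl) (Run.seq h1 h2))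
        h3) ?_ ?_
      · simp [toPair_eq, litWord]
      · rw [List.length_cons, Nat.succ_mul φ.length]
        omega
  have hb : isBit (encodeCNF φ).head? = false := by
    rcases encodeCNF_head φ with h | h <;> rw [h] <;> rfl
  have h1 : Run (.move isBit .F .T) { F := encodeInstance (φ, d) } (4 * w + 1)
      { F := encodeCNF φ, T := (encodeNum d).reverse } :=
    Run.to (run_move (by decide) (encodeNum d) (encodeCNF φ) rfl
      (fun _ => isBit_of_mem_encodeNum) hb) (by simp [Mem.get, Mem.set]) (by omega)
  have h2 : Run (.move anySym .T .D) { F := encodeCNF φ, T := (encodeNum d).reverse } (4 * w + 1)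
      { F := encodeCNF φ, D := encodeNum d } :=
    Run.to (run_move_all (by decide) rfl) (by simp [Mem.get, Mem.set])
      (by simp [Mem.get]; omega)
  refine Run.to (h1.seq (h2.seq (Run.seq (key φ _ hφ hw rfl)
    (run_fork (by decide) (by decide) (by decide) rfl)))) ?_ ?_
  · simp [Mem.get, Mem.set]
  · have h3 := length_litsWord_le hw
    rw [literals_length, List.length_map] at h3
    simp only [Mem.get, List.append_nil, List.length_reverse]
    have h4 : φ.length * (8 * w + 12) + 5 * (2 * φ.length * (w + 1)) =
        φ.length * (18 * w + 22) := by ring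
    omega

/-! ### Comparing the numbers -/

theorem run_halve {m : Mem} {n : ℕ} (hN : m.N = List.replicate n .clause) (hT : m.T = []) :
    Run .halve m (8 * n + 2) { m with N := List.replicate (n / 2) .clause } := by
  have key : ∀ (n : ℕ) (m : Mem), m.N = List.replicate n .clause →
      Run (.loop .N .N (fun a _ => anySym a) (.pop .N ;; .case .N .N fun a _ =>
        if a = none then .nop else .pop .N ;; .push .T .clause)) m (4 * n + 1)
        { m with N := [], T := List.replicate (n / 2) .clause ++ m.T } := by
    intro n
    -- Each pass consumes two symbols and produces one; a lone last symbol is discarded, which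
    -- rounds down.
    induction n using Nat.strong_induction_on with
    | _ n ih =>
      intro m hN
      rcases n with _ | _ | n
      · refine Run.to (Run.loop_done (by rw [Mem.get, hN]; rfl)) ?_ (by omega)
        obtain ⟨⟩ := m
        cases hN
        rfl
      · refine Run.to (Run.loop_step (by rw [Mem.get, hN]; rfl) (Run.seq (Run.pop _ _)
          (Run.case_of none none (by simp [Mem.get, Mem.set, hN]) (by simp [Mem.get, Mem.set, hN])
          (Run.nop _))) (Run.loop_done (by simp [Mem.get, Mem.set, hN, anySym]))) ?_ (by omega)
        simp [Mem.get, Mem.set, hN]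
      · have h1 := ih n (by omega)
          { m with N := List.replicate n .clause, T := .clause :: m.T } rfl
        refine Run.to (Run.loop_step (by rw [Mem.get, hN]; rfl) (Run.seq (Run.pop _ _)
          (Run.case_of (some .clause) (some .clause)
          (by simp [Mem.get, Mem.set, hN, List.replicate_succ])
          (by simp [Mem.get, Mem.set, hN, List.replicate_succ])
          (Run.seq (Run.pop _ _) (Run.push _ _ _)))) (h1.to' ?_)) ?_ (by omega)
        · simp [Mem.get, Mem.set, hN]
        · rw [show (n + 1 + 1) / 2 = n / 2 + 1 by omega, List.replicate_succ']
          simp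
  refine Run.to (Run.seq (key n m hN) (run_move_all (by decide) rfl)) ?_ ?_
  · simp [Mem.get, Mem.set, hT]
  · simp [Mem.get, hT]
    omega

/-- The remainder `n'` is irrelevant to the answer; its bound controls the cost of clearing `N`
afterwards. -/
theorem run_compareBits {K : ℕ} : ∀ (s : List Bool) (n : ℕ) (m : Mem), n ≤ K →
    m.D = s.map Sym.bit → m.N = List.replicate n .clause → m.T = [] →
    ∃ n' ≤ K, Run .compareBits m (s.length * (8 * K + 7) + 1)
      { m with D := [], N := List.replicate n' .clause,
               R := List.replicate (overflow s n) .clause ++ m.R } := by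
  intro s
  induction s with
  | nil =>
    intro n m hK hD hN hT
    refine ⟨n, hK, Run.to (Run.loop_done (by rw [Mem.get, hD]; rfl)) ?_ (by simp)⟩
    obtain ⟨⟩ := m
    cases hD
    cases hN
    rfl
  | cons b s ih =>
    intro n m hK hD hN hT
    rw [List.map_cons] at hD
    have hpop : Run (.pop .D) m 1 { m with D := s.map Sym.bit } :=
      Run.to (Run.pop _ _) (by rw [Mem.get, hD]; rfl) le_rfl
    have hhead : (m.get .D).head? = some (.bit b) := by rw [Mem.get, hD]; rfl
    cases b with
    | false =>
      have h1 := run_halve (m := { m with D := s.map Sym.bit }) hN hT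
      obtain ⟨n', hn', h2⟩ := ih (n / 2)
        { m with D := s.map Sym.bit, N := List.replicate (n / 2) .clause } (by omega) rfl rfl hT
      refine ⟨n', hn', Run.to (Run.loop_step (by rw [hhead]; rfl) (Run.case_of
        (some (.bit false)) (some (.bit false)) hhead hhead (Run.seq hpop (Run.seq (Run.nop _)
        h1))) h2) rfl ?_⟩
      rw [List.length_cons, Nat.succ_mul s.length]
      omega
    | true =>
      have h0 : Run (.case .N .N fun a _ => if a = none then .push .R .clause else .pop .N)
          { m with D := s.map Sym.bit } 2
          { m with D := s.map Sym.bit, N := List.replicate (n - 1) .clause,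
                   R := List.replicate (if n = 0 then 1 else 0) .clause ++ m.R } := by
        cases n with
        | zero =>
          refine Run.to (Run.case_of none none (by rw [Mem.get, hN]; rfl)
            (by rw [Mem.get, hN]; rfl) (Run.push _ _ _)) ?_ le_rfl
          simp [Mem.get, Mem.set, hN]
        | succ n =>
          refine Run.to (Run.case_of (some .clause) (some .clause) (by rw [Mem.get, hN]; rfl)
            (by rw [Mem.get, hN]; rfl) (Run.pop _ _)) ?_ le_rfl
          simp [Mem.get, Mem.set, hN]
      have h1 := run_halve (n := n - 1)
        (m := { m with D := s.map Sym.bit, N := List.replicate (n - 1) .clause,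
                       R := List.replicate (if n = 0 then 1 else 0) .clause ++ m.R }) rfl hT
      obtain ⟨n', hn', h2⟩ := ih ((n - 1) / 2)
        { m with D := s.map Sym.bit, N := List.replicate ((n - 1) / 2) .clause,
                 R := List.replicate (if n = 0 then 1 else 0) .clause ++ m.R }
        (by omega) rfl rfl hT
      refine ⟨n', hn', Run.to (Run.loop_step (by rw [hhead]; rfl) (Run.case_of
        (some (.bit true)) (some (.bit true)) hhead hhead (Run.seq hpop (Run.seq h0
        h1))) h2) ?_ ?_⟩
      · simp only [overflow, ← List.append_assoc, List.replicate_append_replicate,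
          Nat.add_comm (if n = 0 then 1 else 0)]
      · rw [List.length_cons, Nat.succ_mul s.length]
        omega

theorem run_answer {r n' : ℕ} :
    Run .answer { N := List.replicate n' .clause, R := List.replicate r .clause }
      (2 * n' + 2 * r + 5) { R := [.bit (decide (r = 0))] } := by
  refine Run.to (Run.seq (run_clear_all rfl) (Run.case_of (List.replicate r Sym.clause).head?
    (List.replicate r Sym.clause).head? rfl rfl ?_ (n := 2 * r + 2)
    (m' := { R := [.bit (decide (r = 0))] }))) rfl ?_
  · cases r with
    | zero => exact Run.to (Run.push _ _ _) rfl (by omega)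
    | succ r =>
      refine Run.to (Run.seq (run_clear_all rfl) (Run.push _ _ _)) rfl ?_
      simp only [Mem.get, Mem.set, List.length_replicate]
      omega
  · simp only [Mem.get, List.length_replicate]
    omega

/-! ### The decision procedure -/

/-- Together with `overflow_le_length`, this bounds the height of `R`, which has to be cleared
before answering. -/
theorem solve_snd_le (k : ℕ) (φ : List Pair) : (solve k φ).2 ≤ k := by
  induction k generalizing φ with
  | zero => exact le_rfl
  | succ k ih =>
    cases h : order φ with
    | nil => simp [solve, h]
    | cons c ψ =>
      rw [solve_succ h]
      have h1 := ih (outcome (normalize c) ψ).1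
      have h2 : (outcome (normalize c) ψ).2.2 ≤ 1 := by
        unfold outcome
        split <;> simp
      simp only
      omega

theorem overflow_le_length (s : List Bool) (n : ℕ) : overflow s n ≤ s.length := by
  induction s generalizing n with
  | nil => exact le_rfl
  | cons b s ih =>
    cases b with
    | false => exact (ih _).trans (by simp)
    | true =>
      have := ih ((n - 1) / 2)
      simp only [overflow, List.length_cons]
      split_ifs <;> omega

theorem distinctVars_le (k : ℕ) (ls : List Lit) : distinctVars k ls ≤ k := by
  induction k generalizing ls with
  | zero => exact le_rfl
  | succ k ih =>
    cases ls with
    | nil => exact Nat.zero_le _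
    | cons l ls =>
      unfold distinctVars
      split_ifs
      · exact (ih _).trans (Nat.le_succ k)
      · exact Nat.succ_le_succ (ih _)

/-- A bound for the number of steps, for formulas with `k` clauses and names of length `w`. -/
def timeBound (k w : ℕ) : ℕ :=
  (k * (18 * w + 22) + 8 * w + 4) + ((2 * k * (2 * k * (25 * w + 30) + 10 * w + 20) + 1) +
  ((4 * (2 * k * (w + 1)) + 1) + ((4 * (2 * k * (w + 1)) + 1) +
  ((k * (k * (92 * w + 97) + 56 * w + 57) + 1) + ((w * (8 * (2 * k) + 7) + 1) +
  (2 * (2 * k) + 2 * (k + w) + 5))))))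

theorem run_decision {φ : CNF} {d w : ℕ} (hφ : IsTwoCNF φ) (hw : 1 ≤ w)
    (hd : (encodeNum d).length ≤ w) (hnar : Narrow w (literals (φ.map toPair))) :
    Run .decision { F := encodeInstance (φ, d) } (timeBound φ.length w)
      { R := [.bit (decide (failures (φ, d) = 0))] } := by
  have hlen := length_litsWord_le hnar
  rw [literals_length, List.length_map] at hlen
  have h1 := run_parse hφ hd hnar
  have h2 := run_countVars hw (2 * φ.length) (literals (φ.map toPair))
    { F := litsWord (literals (φ.map toPair)), C := litsWord (literals (φ.map toPair)),
      D := encodeNum d } (by rw [literals_length, List.length_map]) le_rfl rfl rfl rfl rfl rfl rfl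
    rfl rfl hnar
  simp only [List.append_nil] at h2
  set n := distinctVars (2 * φ.length) (literals (φ.map toPair)) with hn
  have hnle : n ≤ 2 * φ.length := distinctVars_le _ _
  have h3 : Run (.move anySym .C .T)
      { C := litsWord (literals (φ.map toPair)), D := encodeNum d, N := List.replicate n .clause }
      (4 * (2 * φ.length * (w + 1)) + 1)
      { T := (litsWord (literals (φ.map toPair))).reverse, D := encodeNum d,
        N := List.replicate n .clause } :=
    Run.to (run_move_all (by decide) rfl) (by simp [Mem.get, Mem.set])
      (by simp only [Mem.get]; omega)
  have h4 : Run (.move anySym .T .F)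
      { T := (litsWord (literals (φ.map toPair))).reverse, D := encodeNum d,
        N := List.replicate n .clause } (4 * (2 * φ.length * (w + 1)) + 1)
      { F := litsWord (literals (φ.map toPair)), D := encodeNum d,
        N := List.replicate n .clause } :=
    Run.to (run_move_all (by decide) rfl) (by simp [Mem.get, Mem.set])
      (by simp only [Mem.get, List.length_reverse]; omega)
  have h5 := run_solveLoop hw φ.length (φ.map toPair)
    { F := litsWord (literals (φ.map toPair)), D := encodeNum d, N := List.replicate n .clause }
    (List.length_map _) le_rfl rfl rfl rfl rfl rfl rfl rfl rfl rfl hnar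
  simp only [List.append_nil, List.drop_replicate] at h5
  set r := solve φ.length (φ.map toPair) with hr
  obtain ⟨n', hn', h6⟩ := run_compareBits (K := 2 * φ.length) (Computability.encodeNat d)
    (n - r.1) { D := encodeNum d, N := List.replicate (n - r.1) .clause,
                R := List.replicate r.2 .clause } (by omega) rfl rfl rfl
  have hfail : overflow (Computability.encodeNat d) (n - r.1) + r.2 = failures (φ, d) := by
    rw [add_comm, failures]
  simp only [List.replicate_append_replicate, hfail] at h6
  have hlenD : (Computability.encodeNat d).length ≤ w := by
    simpa [encodeNum] using hd
  have hfle : failures (φ, d) ≤ φ.length + w := by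
    have : r.2 ≤ φ.length := solve_snd_le φ.length (φ.map toPair)
    have := overflow_le_length (Computability.encodeNat d) (n - r.1)
    omega
  refine Run.to (h1.seq (h2.seq (h3.seq (h4.seq (h5.seq (h6.seq run_answer)))))) rfl ?_
  have := Nat.mul_le_mul_right (8 * (2 * φ.length) + 7) hlenD
  unfold timeBound
  omega

/-! ### A polynomial bound in the length of the input -/

theorem timeBound_mono {k k' w w' : ℕ} (hk : k ≤ k') (hw : w ≤ w') :
    timeBound k w ≤ timeBound k' w' := by
  unfold timeBound
  gcongr

theorem exists_polynomial_timeBound :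
    ∃ t : Polynomial ℕ, ∀ n, t.eval n = timeBound n (n + 1) := by
  let x : Polynomial ℕ := Polynomial.X
  let w : Polynomial ℕ := Polynomial.X + 1
  refine ⟨(x * (18 * w + 22) + 8 * w + 4) + ((2 * x * (2 * x * (25 * w + 30) + 10 * w + 20) + 1) +
    ((4 * (2 * x * (w + 1)) + 1) + ((4 * (2 * x * (w + 1)) + 1) +
    ((x * (x * (92 * w + 97) + 56 * w + 57) + 1) + ((w * (8 * (2 * x) + 7) + 1) +
    (2 * (2 * x) + 2 * (x + w) + 5)))))), fun n => ?_⟩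
  simp [x, w, timeBound]

theorem length_le_encodeInstance (I : Instance) : I.1.length ≤ (encodeInstance I).length := by
  obtain ⟨φ, d⟩ := I
  have : ∀ φ : CNF, φ.length ≤ (encodeCNF φ).length := by
    intro φ
    induction φ with
    | nil => exact le_rfl
    | cons C φ ih =>
      simp only [encodeCNF, encodeClause, List.flatMap_cons, List.length_append,
        List.length_cons] at ih ⊢
      omega
  have h := this φ
  simp only [encodeInstance, List.length_append]
  omega

/-- Every variable name is part of the input. The added one makes room for the constant, whose name
has one symbol even when the input is empty. -/
theorem narrow_encodeInstance (I : Instance) :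
    Narrow ((encodeInstance I).length + 1) (literals (I.1.map toPair)) := by
  obtain ⟨φ, d⟩ := I
  have hsub : ∀ {α : Type} (f : α → List Sym) {a : α} {L : List α}, a ∈ L →
      (f a).length ≤ (L.flatMap f).length := fun f a L h =>
    (List.sublist_flatten_of_mem (List.mem_map_of_mem h)).length_le
  have hlit : ∀ C ∈ φ, ∀ l ∈ C, (encodeNum l.1).length ≤ (encodeCNF φ).length := by
    intro C hC l hl
    have h1 : (encodeClause C).length ≤ (encodeCNF φ).length := hsub encodeClause hC
    have h2 := hsub encodeLiteral hl
    simp only [encodeClause, encodeLiteral, List.length_cons] at h1 h2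
    omega
  have hhead : ∀ C ∈ φ, ∀ D : Clause, (∀ l ∈ D, l ∈ C) →
      (nameWord (headLit D).1).length ≤ (encodeInstance (φ, d)).length + 1 := by
    intro C hC D hD
    cases D with
    | nil => simp [headLit, nameWord]
    | cons l D =>
      have := hlit C hC l (hD l (by simp))
      simp only [headLit, liftLit, nameWord, encodeInstance, List.length_append]
      omega
  intro l hl
  simp only [literals, List.mem_flatMap, List.mem_map] at hl
  obtain ⟨_, ⟨C, hC, rfl⟩, hl⟩ := hl
  rw [toPair_eq] at hl
  simp only [List.mem_cons, List.not_mem_nil, or_false] at hl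
  rcases hl with rfl | rfl
  · exact hhead C hC C fun _ h => h
  · exact hhead C hC C.tail fun _ h => List.mem_of_mem_tail h

end MaxDiffer

theorem mainTheorem9 :
    MaxDiffer.PolyTimeSolvable
      (fun I : MaxDiffer.TwoTwoInstance => MaxDiffer.encodeInstance I.1)
      (fun I : MaxDiffer.TwoTwoInstance => MaxDiffer.IsYes I.1) := by
  obtain ⟨t, ht⟩ := MaxDiffer.exists_polynomial_timeBound
  refine MaxDiffer.polyTimeSolvable_of_run _ _ MaxDiffer.Prog.decision t fun I => ?_
  refine ⟨decide (MaxDiffer.failures I.1 = 0), ?_, ?_⟩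
  · rw [decide_eq_true_eq]
    exact MaxDiffer.failures_eq_zero_iff I.2
  · rw [ht]
    refine (MaxDiffer.run_decision I.2.1 (Nat.succ_pos _) ?_
      (MaxDiffer.narrow_encodeInstance I.1)).mono
      (MaxDiffer.timeBound_mono (MaxDiffer.length_le_encodeInstance I.1) le_rfl)
    change (MaxDiffer.encodeNum I.1.2).length ≤
      (MaxDiffer.encodeNum I.1.2 ++ MaxDiffer.encodeCNF I.1.1).length + 1
    rw [List.length_append]
    omega
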